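/- Let $k$ be an algebraically closed field of characteristic $0$, and let $\mathbf X=(X,\mathcal M_X)$ be a fine and saturated log variety over $k$: an integral separated scheme $X$ of finite type over $k$ with a log structure $\alpha\colon\mathcal M_X\to\mathcal O_X$ in the Zariski topology that locally has charts by finitely generated, integral, saturated monoids. For $j\ge 0$ let $X_j\subset X$ be the locally closed subscheme whose underlying set consists of the points $x$ at which the group $(\mathcal M_{X,x}/\mathcal M_{X,x}^*)^{gp}$ has rank $j$, and whose ideal at a point $x\in X_j$ is generated by $\alpha(\mathcal M_{X,x}\setminus\mathcal M_{X,x}^*)$. For $m\ge 0$ let $j_m=\operatorname{Spec}k[t]/(t^{m+1})$, with the trivial log structure. Let $\mathbf J_m(\mathbf X)$ be the log jet scheme of $\mathbf X$, that is, the log scheme over $k$ which represents the functor $\mathbf S\mapsto\operatorname{Hom}(\mathbf S\times_k j_m,\mathbf X)$ on log schemes $\mathbf S$ over $k$, and let $J_m(\mathbf X)$ be its underlying scheme. Let $J_m(X_j)$ be the ordinary jet scheme of $X_j$, that is, the $k$-scheme which represents the functor $S\mapsto\operatorname{Hom}_k(S\times_k j_m,X_j)$ on $k$-schemes $S$. Let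 $J_m(\mathbf X)_j=J_m(\mathbf X)\times_X X_j$ be the (scheme-theoretic) inverse image of $X_j$ under the projection $J_m(\mathbf X)\to X$, $t=0$. Then the jet $J_m(\mathbf X)_j\times_k j_m\to X$ underlying the universal log jet factors through $X_j$, and the resulting morphism $\pi\colon J_m(\mathbf X)_j\to J_m(X_j)$ is a locally trivial $\mathbb A^{mj}$-bundle: every point of $J_m(X_j)$ has an open neighbourhood $W$ such that $\pi^{-1}(W)\cong W\times\mathbb A^{mj}$ over $W$. -/

import Mathlib

open CategoryTheory CategoryTheory.Limits AlgebraicGeometry TopologicalSpace Opposite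

universe u

/-! ### Log structures -/

/-- A log structure on a scheme `X` (Zariski topology): a sheaf of commutative monoids `M` with a
homomorphism of sheaves of monoids `α : M → 𝒪_X` that restricts to an isomorphism
`α⁻¹(𝒪_X^*) ≅ 𝒪_X^*`. -/
structure LogStructure (X : Scheme.{u}) where
  sheaf : TopCat.Sheaf CommMonCat.{u} X
  α (U : X.Opens) : sheaf.presheaf.obj (op U) →* Γ(X, U)
  α_res {U V : X.Opens} (i : U ⟶ V) (s : sheaf.presheaf.obj (op V)) :
    α U (sheaf.presheaf.map i.op s) = X.presheaf.map i.op (α V s)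
  existsUnique_of_isUnit (U : X.Opens) (u : Γ(X, U)) : IsUnit u → ∃! s, α U s = u

namespace LogStructure

variable {X : Scheme.{u}} (L : LogStructure X)

/-- The monoid of sections `M(U)`. -/
abbrev sec (U : X.Opens) : Type u := L.sheaf.presheaf.obj (op U)

/-- Restriction of sections. -/
abbrev res {U V : X.Opens} (i : U ⟶ V) : L.sec V →* L.sec U := (L.sheaf.presheaf.map i.op).hom

theorem res_id (U : X.Opens) (i : U ⟶ U) (s : L.sec U) : L.res i s = s := by
  rw [Subsingleton.elim i (𝟙 U)]
  simp [res]

theorem res_res {U V W : X.Opens} (i : U ⟶ V) (j : V ⟶ W) (s : L.sec W) :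
    L.res i (L.res j s) = L.res (i ≫ j) s := by
  simp [res]

/-- The stalk `M_x`. -/
noncomputable def stalk (x : X) : CommMonCat.{u} :=
  CommMonCat.FilteredColimits.colimit.{u, u} ((OpenNhds.inclusion x).op ⋙ L.sheaf.presheaf)

/-- The germ map `M(U) → M_x`. -/
noncomputable def germ (U : X.Opens) (x : X) (hx : x ∈ U) : L.sec U →* L.stalk x :=
  ((CommMonCat.FilteredColimits.colimitCocone.{u, u}
    ((OpenNhds.inclusion x).op ⋙ L.sheaf.presheaf)).ι.app (op ⟨U, hx⟩)).hom

/-- The rank `r(x)` of the group associated to the characteristic monoid `M_x / M_x^*`. -/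
noncomputable def rank (x : X) : ℕ :=
  Module.finrank ℤ (Additive (Algebra.GrothendieckGroup (Associates (L.stalk x))))

/-- A homomorphism `β : P → M(U)` is a chart if it induces an isomorphism from the log structure
on `U` associated to `P_U → 𝒪_U` to `M|_U`.
It is expressed on stalks: with `F = {p ∈ P | α (β p) ∈ 𝒪_x^*}`, the pushout
`P ⊕_F 𝒪_x^*` maps bijectively to `M_x`, where `𝒪_x^*` is identified with `M_x^*` through `α`.
The pushout consists of the classes of pairs `(p, v)`, and `(p, v)`, `(p', v')` are identified iff
there are `q, q' ∈ F` with `p q = p' q'` and `v β(q') = v' β(q)`. -/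
structure IsChart (U : X.Opens) {P : Type u} [CommMonoid P] (β : P →* L.sec U) : Prop where
  surjective (x : X) (hx : x ∈ U) (s : L.stalk x) :
    ∃ (p : P) (v : (L.stalk x)ˣ), s = L.germ U x hx (β p) * v
  injective (x : X) (hx : x ∈ U) (p p' : P) (v v' : (L.stalk x)ˣ) :
    L.germ U x hx (β p) * v = L.germ U x hx (β p') * v' →
      ∃ q q' : P, IsUnit (L.germ U x hx (β q)) ∧ IsUnit (L.germ U x hx (β q')) ∧
        p * q = p' * q' ∧ v * L.germ U x hx (β q') = v' * L.germ U x hx (β q)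

end LogStructure

/-- An integral monoid `P` is saturated if `g ∈ P^gp` lies in `P` as soon as `g ^ n` does,
for some `n > 0`. -/
def IsSaturatedMonoid (P : Type u) [CommMonoid P] : Prop :=
  ∀ (g : Algebra.GrothendieckGroup P) (n : ℕ), 0 < n →
    g ^ n ∈ Set.range (Algebra.GrothendieckGroup.of (M := P)) →
      g ∈ Set.range (Algebra.GrothendieckGroup.of (M := P))

namespace LogStructure

variable {X : Scheme.{u}} (L : LogStructure X)

/-- A log structure is fine and saturated if each point has a chart by a finitely generated,
integral and saturated monoid. -/
def IsFineSaturated : Prop :=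
  ∀ x : X, ∃ (U : X.Opens) (_ : x ∈ U) (P : Type u) (_ : CommMonoid P) (β : P →* L.sec U),
    Monoid.FG P ∧ IsCancelMul P ∧ IsSaturatedMonoid P ∧ L.IsChart U β

/-- The ideal of `𝒪_{X,x}` generated by `α (M_x ∖ M_x^*)`. -/
noncomputable def nonunitIdeal (x : X) : Ideal (X.presheaf.stalk x) :=
  Ideal.span {f | ∃ (U : X.Opens) (hx : x ∈ U) (s : L.sec U),
    ¬ IsUnit (L.germ U x hx s) ∧ f = X.presheaf.germ U x hx (L.α U s)}

/-- `ι : Z → X` is (the inclusion of) the locally closed subscheme `X_j` of `X`: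
its underlying set is `{x | r(x) = j}`, and near a point of `X_j` its ideal is generated
by `α (M ∖ M^*)`. These conditions determine `Z` as a locally closed subscheme of `X`. -/
structure IsStratum (j : ℕ) {Z : Scheme.{u}} (ι : Z ⟶ X) : Prop where
  isImmersion : IsImmersion ι
  range_eq : Set.range ι = {x : X | L.rank x = j}
  ker_stalkMap (z : Z) : RingHom.ker (ι.stalkMap z).hom = L.nonunitIdeal (ι z)

end LogStructure

/-! ### Log schemes over a field -/

/-- A log scheme over `k`. -/
structure LogScheme (k : Type u) [Field k] where
  /-- the underlying `k`-scheme -/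
  toOver : Over (Spec (CommRingCat.of k))
  log : LogStructure toOver.left

namespace LogScheme

variable {k : Type u} [Field k]

/-- A morphism of log schemes over `k`: a morphism `f : X → Y` of `k`-schemes with a homomorphism
of sheaves of monoids `M_Y → f_* M_X` that is compatible with the maps to `𝒪_Y → f_* 𝒪_X`. -/
structure Hom (X Y : LogScheme k) where
  base : X.toOver ⟶ Y.toOver
  flat (V : Y.toOver.left.Opens) : Y.log.sec V →* X.log.sec (base.left ⁻¹ᵁ V)
  flat_res {U V : Y.toOver.left.Opens} (i : U ⟶ V) (s : Y.log.sec V) :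
    flat U (Y.log.res i s) = X.log.res ((Opens.map base.left.base).map i) (flat V s)
  α_flat (V : Y.toOver.left.Opens) (s : Y.log.sec V) :
    X.log.α _ (flat V s) = base.left.app V (Y.log.α V s)

theorem Hom.ext' {X Y : LogScheme k} {f g : Hom X Y} (h : f.base = g.base)
    (h' : ∀ (V : Y.toOver.left.Opens) (s : Y.log.sec V),
      f.flat V s = X.log.res (eqToHom (by rw [h])) (g.flat V s)) : f = g := by
  obtain ⟨b, φ, _, _⟩ := f
  obtain ⟨b', φ', _, _⟩ := g
  obtain rfl : b = b' := h
  obtain rfl : φ = φ' := by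
    funext V
    ext s
    exact (h' V s).trans (X.log.res_id _ _ _)
  rfl

/-- The identity morphism. -/
noncomputable def Hom.id (X : LogScheme k) : Hom X X where
  base := 𝟙 _
  flat _ := MonoidHom.id _
  flat_res _ _ := rfl
  α_flat _ _ := rfl

/-- Composition of morphisms of log schemes. -/
noncomputable def Hom.comp {X Y Z : LogScheme k} (f : Hom X Y) (g : Hom Y Z) : Hom X Z where
  base := f.base ≫ g.base
  flat V := (f.flat (g.base.left ⁻¹ᵁ V)).comp (g.flat V)
  flat_res i s := (congrArg (f.flat _) (g.flat_res i s)).trans (f.flat_res _ _)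
  α_flat V s := (f.α_flat _ _).trans (congrArg (f.base.left.app _) (g.α_flat V s))

noncomputable instance : Category (LogScheme k) where
  Hom := Hom
  id := Hom.id
  comp := Hom.comp
  id_comp _ := Hom.ext' (Category.id_comp _) fun _ _ => (LogStructure.res_id _ _ _ _).symm
  comp_id _ := Hom.ext' (Category.comp_id _) fun _ _ => (LogStructure.res_id _ _ _ _).symm
  assoc _ _ _ := Hom.ext' (Category.assoc _ _ _) fun _ _ => (LogStructure.res_id _ _ _ _).symm

/-- The underlying `k`-scheme of a log scheme over `k`, as a functor. -/
noncomputable def forget (k : Type u) [Field k] :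
    LogScheme k ⥤ Over (Spec (CommRingCat.of k)) where
  obj X := X.toOver
  map {X Y} f := Hom.base (X := X) (Y := Y) f

end LogScheme

/-! ### Thickenings -/

section Thickening

variable {S T : Scheme.{u}} (i : S ⟶ T) (p : T ⟶ S)

theorem le_preimage_preimage (hip : i ≫ p = 𝟙 S) (hi : Function.Surjective i) (W : T.Opens) :
    W ≤ p ⁻¹ᵁ (i ⁻¹ᵁ W) := by
  intro x hx
  obtain ⟨y, rfl⟩ := hi x
  have : p (i y) = y := by rw [← Scheme.Hom.comp_apply, hip]; rfl
  simpa [this] using hx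

/-- The monoid of `g ∈ 𝒪_T(W)` with `i^♯ g = 1`. If `T = S × Spec k[t]/(t^{m+1})` and `i` is the
zero section `t = 0`, it is the group `G = {1 + a₁ t + ⋯ + a_m t^m | a_i ∈ 𝒪_S(i⁻¹ W)}`. -/
abbrev oneUnits (W : T.Opens) : Submonoid Γ(T, W) :=
  MonoidHom.mker ((i.app W).hom : Γ(T, W) →* Γ(S, i ⁻¹ᵁ W))

theorem app_res {V W : T.Opens} (a : V ⟶ W) (g : Γ(T, W)) :
    i.app V (T.presheaf.map a.op g) =
      S.presheaf.map ((Opens.map i.base).map a).op (i.app W g) := by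
  have := congrArg (fun f => f.hom g) (i.naturality a.op)
  exact this

/-- The restriction maps of `W ↦ {g ∈ 𝒪_T(W) | i^♯ g = 1}`. -/
def oneUnitsRes {V W : T.Opens} (a : V ⟶ W) : oneUnits i W →* oneUnits i V :=
  ((((T.presheaf.map a.op).hom : Γ(T, W) →* Γ(T, V)).comp (Submonoid.subtype _)).codRestrict _
    fun g => by
      obtain ⟨g, hg⟩ := g
      rw [MonoidHom.mem_mker] at hg ⊢
      refine (app_res i a g).trans ?_
      erw [hg]
      exact map_one _)

/-- The presheaf of monoids `W ↦ M_S(i⁻¹ W) × {g ∈ 𝒪_T(W) | i^♯ g = 1}` on `T`. -/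
noncomputable def LogStructure.thickenPresheaf (L : LogStructure S) :
    TopCat.Presheaf CommMonCat.{u} T where
  obj W := CommMonCat.of (L.sec (i ⁻¹ᵁ W.unop) × oneUnits i W.unop)
  map {V W} a := CommMonCat.ofHom <| MonoidHom.prodMap
    (L.res ((Opens.map i.base).map a.unop)) (oneUnitsRes i a.unop)
  map_id W := by
    ext ⟨m, g⟩
    · exact L.res_id _ _ _
    · change T.presheaf.map (𝟙 W) g.1 = g.1
      rw [T.presheaf.map_id]
      rfl
  map_comp {U V W} a b := by
    ext ⟨m, g⟩
    · exact (L.res_res _ _ _).symm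
    · change T.presheaf.map (a ≫ b) g.1 = T.presheaf.map b (T.presheaf.map a g.1)
      rw [T.presheaf.map_comp]
      rfl

theorem LogStructure.thickenPresheaf_isSheaf (L : LogStructure S) :
    (L.thickenPresheaf i).IsSheaf := by
  rw [TopCat.Presheaf.isSheaf_iff_isSheaf_comp (forget CommMonCat)]
  apply TopCat.Presheaf.isSheaf_of_isSheafUniqueGluing_types
  intro ι U sf hsf
  have h1 : i ⁻¹ᵁ (iSup U) ≤ iSup fun j => i ⁻¹ᵁ (U j) := by
    intro x hx
    simpa using hx
  obtain ⟨m, hm, hm'⟩ := L.sheaf.existsUnique_gluing' (fun j => i ⁻¹ᵁ (U j)) (i ⁻¹ᵁ (iSup U))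
    (fun j => (Opens.map i.base).map (Opens.leSupr U j)) h1 (fun j => (sf j).1) (fun a b => by
      exact congrArg Prod.fst (hsf a b))
  obtain ⟨g, hg, hg'⟩ := T.sheaf.existsUnique_gluing' U (iSup U)
    (fun j => Opens.leSupr U j) le_rfl (fun j => (sf j).2.1) (fun a b =>
      congrArg (fun x => x.2.1) (hsf a b))
  have hg1 : i.app (iSup U) g = 1 := by
    refine S.sheaf.eq_of_locally_eq' (fun j => i ⁻¹ᵁ (U j)) (i ⁻¹ᵁ (iSup U))
      (fun j => (Opens.map i.base).map (Opens.leSupr U j)) h1 _ _ fun j => ?_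
    refine (app_res i (Opens.leSupr U j) g).symm.trans ?_
    refine (congrArg (i.app (U j)) (hg j)).trans ?_
    refine (MonoidHom.mem_mker.1 (sf j).2.2).trans ?_
    exact (map_one _).symm
  refine ⟨(m, ⟨g, hg1⟩), fun j => Prod.ext (hm j) (Subtype.ext (hg j)), ?_⟩
  rintro ⟨m', g'⟩ h
  refine Prod.ext (hm' _ fun j => congrArg Prod.fst (h j)) (Subtype.ext (hg' _ fun j => ?_))
  exact congrArg (fun x => x.2.1) (h j)

theorem app_appLE_apply (hip : i ≫ p = 𝟙 S) (W : T.Opens) (h : W ≤ p ⁻¹ᵁ (i ⁻¹ᵁ W))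
    (a : Γ(S, i ⁻¹ᵁ W)) : i.app W (p.appLE (i ⁻¹ᵁ W) W h a) = a := by
  have h2 := Scheme.Hom.appLE_comp_appLE i p (i ⁻¹ᵁ W) W (i ⁻¹ᵁ W) h le_rfl
  have h3 : i.appLE W (i ⁻¹ᵁ W) le_rfl = i.app W := Scheme.Hom.app_eq_appLE i |>.symm
  have h4 : ∀ (f : S ⟶ S) (hf : f = 𝟙 S) (V : S.Opens) (e : V ≤ f ⁻¹ᵁ V), f.appLE V V e = 𝟙 _ := by
    rintro f rfl V e
    rw [Scheme.Hom.appLE, Scheme.Hom.id_app]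
    exact (Category.id_comp _).trans (S.presheaf.map_id _)
  rw [h4 _ hip, h3] at h2
  exact congrArg (fun f => f.hom a) h2

/-- Let `i : S → T` be surjective with a retraction `p : T → S`, for example the zero section and the
projection of `T = S × Spec k[t]/(t^{m+1})`. The log structure `M_T = i_* M_S × G` on `T`, with
`G = {g ∈ 𝒪_T | i^♯ g = 1}` and `α (s, g) = p^♯ (α s) * g`. In the example this is the log structure
associated to `M_S → 𝒪_S → 𝒪_T`, that is, the log structure of the product of `S` with
`Spec k[t]/(t^{m+1})`, where the latter has the trivial log structure. -/
noncomputable def LogStructure.thicken (hip : i ≫ p = 𝟙 S) (hi : Function.Surjective i)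
    (L : LogStructure S) : LogStructure T where
  sheaf := ⟨L.thickenPresheaf i, L.thickenPresheaf_isSheaf i⟩
  α W := MonoidHom.coprod
    (((p.appLE (i ⁻¹ᵁ W) W (le_preimage_preimage i p hip hi W)).hom : _ →* Γ(T, W)).comp (L.α _))
    (Submonoid.subtype _)
  α_res := by
    rintro U V a ⟨m, g⟩
    have h1 := L.α_res ((Opens.map i.base).map a) m
    have h2 : T.presheaf.map a.op (p.appLE (i ⁻¹ᵁ V) V (le_preimage_preimage i p hip hi V) (L.α _ m))
        = p.appLE (i ⁻¹ᵁ U) U (le_preimage_preimage i p hip hi U)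
          (S.presheaf.map ((Opens.map i.base).map a).op (L.α _ m)) := by
      rw [← CommRingCat.comp_apply, ← CommRingCat.comp_apply, Scheme.Hom.appLE_map,
        Scheme.Hom.map_appLE]
    refine Eq.trans ?_ (map_mul (T.presheaf.map a.op).hom _ _).symm
    exact congrArg₂ (· * ·) ((congrArg _ h1).trans h2.symm) rfl
  existsUnique_of_isUnit := by
    intro W u hu
    have hW := le_preimage_preimage i p hip hi W
    have hu' : IsUnit (i.app W u) := hu.map (i.app W).hom
    obtain ⟨m, hm, hm'⟩ := L.existsUnique_of_isUnit _ _ hu'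
    have hv : IsUnit (p.appLE (i ⁻¹ᵁ W) W hW (i.app W u)) := hu'.map (p.appLE _ _ hW).hom
    obtain ⟨v, hv⟩ := hv
    have hi1 : i.app W (v : Γ(T, W)) = i.app W u := by
      rw [hv]; exact app_appLE_apply i p hip W hW _
    have hg : i.app W ((v⁻¹ : Γ(T, W)ˣ) * u : Γ(T, W)) = 1 := by
      rw [map_mul, ← hi1, ← map_mul]
      simp
    refine ⟨(m, ⟨_, hg⟩), ?_, ?_⟩
    · refine (congrArg₂ (· * ·) ((congrArg _ hm).trans hv.symm) rfl : _ = _).trans ?_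
      exact Units.mul_inv_cancel_left v u
    · rintro ⟨m', g, hg'⟩ h
      have h : p.appLE (i ⁻¹ᵁ W) W hW (L.α _ m') * g = u := h
      have h5 : L.α _ m' = i.app W u := by
        rw [← h, map_mul, app_appLE_apply i p hip]
        erw [MonoidHom.mem_mker.1 hg']
        simp
      obtain rfl := hm' m' h5
      refine Prod.ext rfl (Subtype.ext ?_)
      rw [h5, ← hv] at h
      simp [← h]

theorem preimage_eq {S' T' : Scheme.{u}} {i' : S' ⟶ T'} {g : S ⟶ S'} {h : T ⟶ T'}
    (comm : i ≫ h = g ≫ i') (W : T'.Opens) : i ⁻¹ᵁ (h ⁻¹ᵁ W) = g ⁻¹ᵁ (i' ⁻¹ᵁ W) := by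
  rw [← Scheme.Hom.comp_preimage, comm, Scheme.Hom.comp_preimage]

theorem app_app_of_comm {S' T' : Scheme.{u}} {i' : S' ⟶ T'} {g : S ⟶ S'} {h : T ⟶ T'}
    (comm : i ≫ h = g ≫ i') (W : T'.Opens) (a : Γ(T', W)) :
    i.app (h ⁻¹ᵁ W) (h.app W a) =
      S.presheaf.map (eqToHom (preimage_eq i comm W)).op (g.app _ (i'.app W a)) := by
  have h1 : ∀ (f : S ⟶ T') (hf : i ≫ h = f),
      (i ≫ h).app W = f.app W ≫ S.presheaf.map (eqToHom (by rw [hf])).op := by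
    rintro f rfl
    rw [eqToHom_refl, op_id]
    exact ((congrArg (_ ≫ ·) (S.presheaf.map_id _)).trans (Category.comp_id _)).symm
  have h2 := h1 _ comm
  rw [Scheme.Hom.comp_app, Scheme.Hom.comp_app] at h2
  exact congrArg (fun f : Γ(T', W) ⟶ Γ(S, i ⁻¹ᵁ (h ⁻¹ᵁ W)) => f.hom a) h2

theorem app_congr {f f' : S ⟶ T} (h : f = f') (W : T.Opens) (a : Γ(T, W)) :
    f.app W a = S.presheaf.map (eqToHom (by rw [h])).op (f'.app W a) := by
  subst h
  rw [eqToHom_refl, op_id, S.presheaf.map_id]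
  rfl

/-- A commutative square `(S → T) → (S' → T')` induces `G_{T'}(W) → G_T(h⁻¹ W)`. -/
noncomputable def oneUnitsMap {S' T' : Scheme.{u}} {i' : S' ⟶ T'} {g : S ⟶ S'} {h : T ⟶ T'}
    (comm : i ≫ h = g ≫ i') (W : T'.Opens) : oneUnits i' W →* oneUnits i (h ⁻¹ᵁ W) :=
  (((h.app W).hom : Γ(T', W) →* Γ(T, h ⁻¹ᵁ W)).comp (Submonoid.subtype _)).codRestrict _
    fun a => by
      obtain ⟨a, ha⟩ := a
      rw [MonoidHom.mem_mker] at ha ⊢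
      refine (app_app_of_comm i comm W a).trans ?_
      have ha : i'.app W a = 1 := ha
      rw [ha, map_one]
      exact map_one _

theorem appLE_app_of_comm {S' T' : Scheme.{u}} {i' : S' ⟶ T'} {p' : T' ⟶ S'} {g : S ⟶ S'}
    {h : T ⟶ T'} (comm : i ≫ h = g ≫ i') (comm' : h ≫ p' = p ≫ g) (W : T'.Opens)
    (e : h ⁻¹ᵁ W ≤ p ⁻¹ᵁ (i ⁻¹ᵁ (h ⁻¹ᵁ W))) (e' : W ≤ p' ⁻¹ᵁ (i' ⁻¹ᵁ W)) (a : Γ(S', i' ⁻¹ᵁ W)) :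
    p.appLE _ _ e (S.presheaf.map (eqToHom (preimage_eq i comm W)).op (g.app _ a)) =
      h.app W (p'.appLE _ _ e' a) := by
  rw [← CommRingCat.comp_apply, ← CommRingCat.comp_apply, ← CommRingCat.comp_apply,
    Scheme.Hom.app_eq_appLE, Scheme.Hom.app_eq_appLE, Scheme.Hom.appLE_map_assoc,
    Scheme.Hom.appLE_comp_appLE, Scheme.Hom.appLE_comp_appLE]
  simp only [comm']

end Thickening

/-! ### Jets -/

section Jets

variable (k : Type u) [Field k] (m : ℕ)

/-- The ring `k[t]/(t^{m+1})`. -/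
abbrev JetRing : Type u := Polynomial k ⧸ Ideal.span {(Polynomial.X ^ (m + 1) : Polynomial k)}

/-- The `k`-algebra homomorphism `k[t]/(t^{m+1}) → k` with `t ↦ 0`. -/
noncomputable def JetRing.eval : JetRing k m →+* k :=
  Ideal.Quotient.lift _ (Polynomial.evalRingHom 0) (fun a ha => by
    obtain ⟨b, rfl⟩ := Ideal.mem_span_singleton.1 ha
    simp)

/-- The morphism `j_m = Spec k[t]/(t^{m+1}) → Spec k`. -/
noncomputable abbrev jetStr : Spec (CommRingCat.of (JetRing k m)) ⟶ Spec (CommRingCat.of k) :=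
  Spec.map (CommRingCat.ofHom (algebraMap k (JetRing k m)))

/-- The `k`-point `t = 0` of `j_m`. -/
noncomputable abbrev jetZero : Spec (CommRingCat.of k) ⟶ Spec (CommRingCat.of (JetRing k m)) :=
  Spec.map (CommRingCat.ofHom (JetRing.eval k m))

theorem JetRing.eval_algebraMap (a : k) : JetRing.eval k m (algebraMap k (JetRing k m) a) = a := by
  change Polynomial.evalRingHom 0 (Polynomial.C a) = a
  simp

theorem jetZero_jetStr : jetZero k m ≫ jetStr k m = 𝟙 _ := by
  rw [← Spec.map_comp, ← CommRingCat.ofHom_comp]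
  have : (JetRing.eval k m).comp (algebraMap k (JetRing k m)) = RingHom.id k :=
    RingHom.ext (JetRing.eval_algebraMap k m)
  rw [this]
  exact Spec.map_id _

theorem jetZero_surjective : Function.Surjective (jetZero k m) := by
  have h1 : Function.Surjective (JetRing.eval k m) := fun a => ⟨_, JetRing.eval_algebraMap k m a⟩
  have h2 : RingHom.ker (JetRing.eval k m) ≤ nilradical (JetRing k m) := by
    intro x hx
    obtain ⟨q, rfl⟩ := Ideal.Quotient.mk_surjective x
    have hq : Polynomial.eval 0 q = 0 := hx
    obtain ⟨r, rfl⟩ := Polynomial.X_dvd_iff.2 ((Polynomial.coeff_zero_eq_eval_zero q).trans hq)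
    refine mem_nilradical.2 ⟨m + 1, ?_⟩
    rw [← map_pow, Ideal.Quotient.eq_zero_iff_mem, Ideal.mem_span_singleton, mul_pow]
    exact dvd_mul_right _ _
  intro x
  have : x ∈ Set.range (PrimeSpectrum.comap (JetRing.eval k m)) := by
    rw [range_comap_of_surjective _ _ h1]
    intro y hy
    exact (mem_nilradical.1 (h2 hy)).elim fun n hn =>
      (PrimeSpectrum.isPrime x).mem_of_pow_mem n (hn ▸ Submodule.zero_mem _)
  exact this

variable {k}

/-- `T × j_m` (fibre product over `k`), as a functor in the `k`-scheme `T`. -/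
noncomputable def thickening : Over (Spec (CommRingCat.of k)) ⥤ Over (Spec (CommRingCat.of k)) where
  obj T := Over.mk (pullback.fst T.hom (jetStr k m) ≫ T.hom)
  map {S T} f := Over.homMk
    (pullback.lift (pullback.fst S.hom (jetStr k m) ≫ f.left) (pullback.snd S.hom (jetStr k m))
      (by rw [Category.assoc, Over.w f, pullback.condition]))
    (by
      refine (Category.assoc _ _ _).symm.trans ?_
      rw [pullback.lift_fst, Category.assoc, Over.w f]
      rfl)
  map_id T := by
    apply Over.OverMorphism.ext
    apply pullback.hom_ext
    · exact (pullback.lift_fst _ _ _).trans ((Category.comp_id _).trans (Category.id_comp _).symm)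
    · exact (pullback.lift_snd _ _ _).trans (Category.id_comp _).symm
  map_comp f g := by
    apply Over.OverMorphism.ext
    apply pullback.hom_ext
    · refine (pullback.lift_fst _ _ _).trans ?_
      refine Eq.trans ?_ (Category.assoc _ _ _).symm
      refine Eq.trans ?_ (congrArg (_ ≫ ·) (pullback.lift_fst _ _ _).symm)
      refine Eq.trans ?_ (Category.assoc _ _ _)
      refine Eq.trans ?_ (congrArg (· ≫ _) (pullback.lift_fst _ _ _).symm)
      exact (Category.assoc _ _ _).symm
    · refine (pullback.lift_snd _ _ _).trans ?_
      refine Eq.trans ?_ (Category.assoc _ _ _).symm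
      refine Eq.trans ?_ (congrArg (_ ≫ ·) (pullback.lift_snd _ _ _).symm)
      exact (pullback.lift_snd _ _ _).symm

variable (T : Over (Spec (CommRingCat.of k)))

/-- The projection `T × j_m → T`. -/
noncomputable def thickeningProj : (thickening m).obj T ⟶ T :=
  Over.homMk (pullback.fst T.hom (jetStr k m)) rfl

theorem jetZero_comm :
    𝟙 T.left ≫ T.hom = (T.hom ≫ jetZero k m) ≫ jetStr k m := by
  rw [Category.assoc, jetZero_jetStr, Category.comp_id, Category.id_comp]

/-- The closed immersion `T → T × j_m` given by `t = 0`. -/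
noncomputable def thickeningZero : T ⟶ (thickening m).obj T :=
  Over.homMk (pullback.lift (𝟙 _) (T.hom ≫ jetZero k m) (jetZero_comm m T)) (by
    refine (Category.assoc _ _ _).symm.trans ?_
    refine (congrArg (· ≫ _) (pullback.lift_fst _ _ _)).trans ?_
    exact Category.id_comp _)

theorem thickeningZero_proj : (thickeningZero m T).left ≫ (thickeningProj m T).left = 𝟙 _ :=
  pullback.lift_fst _ _ _

theorem thickeningZero_surjective : Function.Surjective (thickeningZero m T).left := by
  have h : IsPullback (pullback.lift (𝟙 _) (T.hom ≫ jetZero k m) (jetZero_comm m T)) T.hom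
      (pullback.snd T.hom (jetStr k m)) (jetZero k m) := by
    refine IsPullback.of_right (h₁₂ := pullback.fst _ _) (h₂₂ := jetStr k m) (v₁₃ := T.hom) ?_
      (pullback.lift_snd _ _ _) (IsPullback.of_hasPullback T.hom (jetStr k m))
    rw [pullback.lift_fst, jetZero_jetStr]
    exact IsPullback.of_horiz_isIso ⟨by simp⟩
  have : Surjective (jetZero k m) := ⟨jetZero_surjective k m⟩
  have h2 : Surjective (pullback.lift (𝟙 _) (T.hom ≫ jetZero k m) (jetZero_comm m T)) :=
    MorphismProperty.of_isPullback h.flip this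
  exact h2.surj

theorem thickeningZero_naturality {S T : Over (Spec (CommRingCat.of k))} (f : S ⟶ T) :
    thickeningZero m S ≫ (thickening m).map f = f ≫ thickeningZero m T := by
  apply Over.OverMorphism.ext
  apply pullback.hom_ext
  · refine (Category.assoc _ _ _).trans ?_
    refine (congrArg (_ ≫ ·) (pullback.lift_fst _ _ _)).trans ?_
    refine (Category.assoc _ _ _).symm.trans ?_
    refine (congrArg (· ≫ _) (pullback.lift_fst _ _ _)).trans ?_
    refine (Category.id_comp _).trans ?_
    refine Eq.trans ?_ (Category.assoc _ _ _).symm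
    refine Eq.trans ?_ (congrArg (_ ≫ ·) (pullback.lift_fst _ _ _).symm)
    exact (Category.comp_id _).symm
  · refine (Category.assoc _ _ _).trans ?_
    refine (congrArg (_ ≫ ·) (pullback.lift_snd _ _ _)).trans ?_
    refine (pullback.lift_snd _ _ _).trans ?_
    refine Eq.trans ?_ (Category.assoc _ _ _).symm
    refine Eq.trans ?_ (congrArg (_ ≫ ·) (pullback.lift_snd _ _ _).symm)
    rw [← Category.assoc, Over.w f]

theorem thickeningProj_naturality {S T : Over (Spec (CommRingCat.of k))} (f : S ⟶ T) :
    (thickening m).map f ≫ thickeningProj m T = thickeningProj m S ≫ f :=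
  Over.OverMorphism.ext (pullback.lift_fst _ _ _)

end Jets

namespace LogScheme

variable {k : Type u} [Field k] (m : ℕ)

/-- The product `S × j_m` of a log scheme `S` with `j_m` (endowed with the trivial log structure):
its underlying scheme is the fibre product over `k`, its sheaf of monoids is `M_S × G` with
`G = {1 + a₁ t + ⋯ + a_m t^m | a_i ∈ 𝒪_S}`, and `α (s, g) = α_S(s) * g`. -/
noncomputable def thickenObj (S : LogScheme k) : LogScheme k where
  toOver := (thickening m).obj S.toOver
  log := S.log.thicken (thickeningZero m S.toOver).left (thickeningProj m S.toOver).left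
    (thickeningZero_proj m S.toOver) (thickeningZero_surjective m S.toOver)

theorem thicken_comm {S S' : Over (Spec (CommRingCat.of k))} (f : S ⟶ S') :
    (thickeningZero m S).left ≫ ((thickening m).map f).left =
      f.left ≫ (thickeningZero m S').left :=
  congrArg (fun g : S ⟶ (thickening m).obj S' => g.left) (thickeningZero_naturality m f)

theorem thicken_comm' {S S' : Over (Spec (CommRingCat.of k))} (f : S ⟶ S') :
    ((thickening m).map f).left ≫ (thickeningProj m S').left =
      (thickeningProj m S).left ≫ f.left :=
  congrArg (fun g : (thickening m).obj S ⟶ S' => g.left) (thickeningProj_naturality m f)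

/-- The morphism `f × j_m : S × j_m → S' × j_m` induced by a morphism `f : S → S'` of log schemes.
On `M_S' × G_S' → M_S × G_S` it is given by `f` and by the pullback of functions. -/
noncomputable def thickenMap {S S' : LogScheme k} (f : Hom S S') :
    Hom (thickenObj m S) (thickenObj m S') where
  base := (thickening m).map f.base
  flat W := MonoidHom.prodMap
    ((S.log.res (eqToHom (preimage_eq _ (thicken_comm m f.base) W))).comp
      (f.flat ((thickeningZero m S'.toOver).left ⁻¹ᵁ W)))
    (oneUnitsMap _ (thicken_comm m f.base) W)
  flat_res {U V} i s := by
    obtain ⟨a, g⟩ := s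
    refine Prod.ext ?_ (Subtype.ext ?_)
    · refine (congrArg _ (f.flat_res ((Opens.map (thickeningZero m S'.toOver).left.base).map i)
        a)).trans ?_
      refine (S.log.res_res _ _ _).trans ?_
      exact (S.log.res_res ((Opens.map (thickeningZero m S.toOver).left.base).map
        ((Opens.map ((thickening m).map f.base).left.base).map i))
        (eqToHom (preimage_eq _ (thicken_comm m f.base) V)) (f.flat _ a)).symm
    · exact app_res ((thickening m).map f.base).left i g.1
  α_flat W s := by
    obtain ⟨a, g⟩ := s
    refine Eq.trans ?_ (map_mul (((thickening m).map f.base).left.app W).hom _ _).symm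
    refine (congrArg (· * ((thickening m).map f.base).left.app W g.1) ?_ :)
    refine Eq.trans ?_ (appLE_app_of_comm _ _ (thicken_comm m f.base) (thicken_comm' m f.base) W
      (le_preimage_preimage _ _ (thickeningZero_proj m S.toOver)
        (thickeningZero_surjective m S.toOver) _)
      (le_preimage_preimage _ _ (thickeningZero_proj m S'.toOver)
        (thickeningZero_surjective m S'.toOver) _) (S'.log.α _ a))
    have h1 := (S.log.α_res (eqToHom (preimage_eq _ (thicken_comm m f.base) W)) (f.flat _ a)).trans
      (congrArg (S.toOver.left.presheaf.map
        (eqToHom (preimage_eq _ (thicken_comm m f.base) W)).op) (f.α_flat _ a))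
    exact congrArg ((thickeningProj m S.toOver).left.appLE _ _ _) h1

/-- `S ↦ S × j_m` as an endofunctor of the category of log schemes over `k`. -/
noncomputable def thicken : LogScheme k ⥤ LogScheme k where
  obj := thickenObj m
  map {S S'} f := thickenMap m (S := S) (S' := S') f
  map_id S := by
    refine Hom.ext' ((thickening m).map_id _) fun W s => ?_
    exact Prod.ext rfl (Subtype.ext (app_congr ((congrArg (fun f => f.left)
      ((thickening m).map_id S.toOver) : _ = 𝟙 _)) W s.2.1))
  map_comp {S S' S''} f g := by
    refine Hom.ext' ((thickening m).map_comp _ _) fun W s => ?_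
    refine Prod.ext ?_ (Subtype.ext (app_congr (congrArg (fun f => f.left)
      ((thickening m).map_comp f.base g.base)) W s.2.1))
    have h1 := f.flat_res (eqToHom (preimage_eq _ (thicken_comm m g.base) W)) (g.flat _ s.1)
    have h2 := congrArg (S.log.res (eqToHom (preimage_eq _ (thicken_comm m f.base)
      (((thickening m).map g.base).left ⁻¹ᵁ W)))) h1
    rw [LogStructure.res_res] at h2
    have h3 : (thickeningZero m S.toOver).left ⁻¹ᵁ (((thickening m).map (f.base ≫ g.base)).left ⁻¹ᵁ W)
        = (thickeningZero m S.toOver).left ⁻¹ᵁ (((thickening m).map f.base).left ⁻¹ᵁ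
          (((thickening m).map g.base).left ⁻¹ᵁ W)) := by
      rw [(thickening m).map_comp]
      rfl
    have h4 := congrArg (S.log.res (eqToHom h3)) h2
    exact (S.log.res_res _ _ _).symm.trans h4.symm

/-- The functor `S ↦ Hom (S × j_m, X)` of log jets in `X`, on all log schemes `S` over `k`. The
`m`-th log jet scheme of `X` is the log scheme that represents it. -/
noncomputable def logJets (X : LogScheme k) : (LogScheme k)ᵒᵖ ⥤ Type u :=
  (thicken m).op ⋙ yoneda.obj X

end LogScheme

/-- The functor `S ↦ Hom (S × j_m, X)` of (ordinary) jets in a `k`-scheme `X`, on all `k`-schemes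
`S`. The `m`-th jet scheme of `X` is the `k`-scheme that represents it. -/
noncomputable def jets {k : Type u} [Field k] (m : ℕ) (X : Over (Spec (CommRingCat.of k))) :
    (Over (Spec (CommRingCat.of k)))ᵒᵖ ⥤ Type u :=
  (thickening m).op ⋙ yoneda.obj X

namespace LogScheme

variable {k : Type u} [Field k] {m : ℕ} {X J : LogScheme k}

/-- The universal log jet `J × j_m → X` of a log jet scheme `J` of `X`. -/
noncomputable def univLogJet (hJ : (X.logJets m).RepresentableBy J) : (thicken m).obj J ⟶ X :=
  hJ.homEquiv (𝟙 J)

/-- The projection `J_m(X) → X` of underlying schemes: the universal log jet at `t = 0`. -/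
noncomputable def logJetProj (hJ : (X.logJets m).RepresentableBy J) : J.toOver ⟶ X.toOver :=
  thickeningZero m J.toOver ≫ (forget k).map (univLogJet hJ)

/-- The inverse image `J_m(X)_Z` of a subscheme `ι : Z → X` under the projection `J_m(X) → X`. -/
noncomputable def logJetsOver (hJ : (X.logJets m).RepresentableBy J)
    {Z : Over (Spec (CommRingCat.of k))} (ι : Z ⟶ X.toOver) : Over (Spec (CommRingCat.of k)) :=
  Over.mk (pullback.fst (logJetProj hJ).left ι.left ≫ J.toOver.hom)

/-- The inclusion `J_m(X)_Z → J_m(X)`. -/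
noncomputable def logJetsOverIncl (hJ : (X.logJets m).RepresentableBy J)
    {Z : Over (Spec (CommRingCat.of k))} (ι : Z ⟶ X.toOver) : logJetsOver hJ ι ⟶ J.toOver :=
  Over.homMk (pullback.fst (logJetProj hJ).left ι.left) rfl

end LogScheme

/-- The universal jet `J' × j_m → Z` of a jet scheme `J'` of `Z`. -/
noncomputable def univJet {k : Type u} [Field k] {m : ℕ} {Z J' : Over (Spec (CommRingCat.of k))}
    (hJ' : (jets m Z).RepresentableBy J') : (thickening m).obj J' ⟶ Z :=
  hJ'.homEquiv (𝟙 J')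

/-- `π : E → B` is a locally trivial `𝔸ⁿ`-bundle: Zariski locally on `B` it is isomorphic to the
projection `B × 𝔸ⁿ → B`. -/
def IsLocallyTrivialAffineBundle (n : ℕ) {E B : Scheme.{u}} (π : E ⟶ B) : Prop :=
  ∀ b : B, ∃ (W : B.Opens) (_ : b ∈ W)
    (e : (π ⁻¹ᵁ W).toScheme ≅ 𝔸(ULift.{u} (Fin n); W.toScheme)),
    e.hom ≫ (𝔸(ULift.{u} (Fin n); W.toScheme) ↘ W.toScheme) = π ∣_ W

/-! The morphism `π` is studied through its `T`-points. Give a `k`-scheme `T` the log structure `𝒪 →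
𝒪`. Log morphisms `ofScheme T ⟶ Y` are then the same as morphisms from `T` to the underlying scheme
of `Y`, so `T`-points of `J_m(X)` are log jets `T × j_m → X` (`logJetOf_bijective`).

The log structure of `T × j_m` is `𝒪_T × G`, where `G` consists of the units `1 + a₁ t + ⋯ + a_m
t^m`. A log jet is therefore a jet `φ` together with a multiplicative family of factors `g(s) ∈ G`
such that `φ^♯ α(s) = (φ^♯ α(s))|_{t=0} * g(s)` (`pullbackFun_eq_mul_twist`). If the jet starts in
`X_j`, the right side vanishes for every nonunit `s`. Hence so does the left side, and the whole jet
lies in `X_j` (`exists_jet_in_stratum`).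

Now fix a jet `φ` in `X_j` whose image lies in the domain of a chart `P`, and let `F ⊆ P` be the
face of elements that are units along the stratum. For `q ∈ F` the factor `g(q)` is a quotient of
units and is determined by `φ`. For `p ∉ F` the equation reads `0 = 0` and leaves `g(p)` free. Log
jets over `φ` thus correspond to the extensions to `P^gp` of a given homomorphism `F → G`; the
passage between a chart and the whole sheaf `M` is `exists_extension` and `eq_of_eq_on_chart`. Since
`P` is saturated and `F` is a face, `P^gp / F^gp` is free of rank `j` (`exists_basis_mod_face`). An
extension is thus a free choice of `j` elements of `G`, that is, of `mj` functions on `T`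
(`jetUnitOf_bijective`). These coordinates are compatible with pullback in `T`, and
`exists_iso_affineSpace` turns this into an isomorphism with `W × 𝔸^{mj}`, where `W` consists of the
jets that start in the domain of the chart. -/

/-! ### Faces of monoids -/

section Face

open Algebra

theorem Algebra.GrothendieckGroup.exists_eq_div {M : Type*} [CommMonoid M]
    (x : GrothendieckGroup M) :
    ∃ a b : M, x = GrothendieckGroup.of a / GrothendieckGroup.of b := by
  induction x using Localization.ind with
  | H y =>
    obtain ⟨a, b, hb⟩ := y
    refine ⟨a, b, ?_⟩
    simp only [GrothendieckGroup.of, Submonoid.LocalizationMap.toMonoidHom_apply,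
      ← Localization.mk_one_eq_monoidOf_mk]
    rw [GrothendieckGroup.mk_div_mk]
    simp

theorem Algebra.GrothendieckGroup.lift_of {M G : Type*} [CommMonoid M] [CommGroup G] (f : M →* G)
    (x : M) : GrothendieckGroup.lift f (GrothendieckGroup.of x) = f x :=
  DFunLike.congr_fun (GrothendieckGroup.lift.symm_apply_apply f) x

theorem Algebra.GrothendieckGroup.of_eq_of_iff {M : Type*} [CommMonoid M] (a b : M) :
    GrothendieckGroup.of a = GrothendieckGroup.of b ↔ ∃ c, c * a = c * b := by
  simp only [GrothendieckGroup.of, Submonoid.LocalizationMap.toMonoidHom_apply]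
  rw [(Localization.monoidOf (⊤ : Submonoid M)).eq_iff_exists]
  simp

variable {P : Type*} [CommMonoid P] (F : Submonoid P)

/-- The homomorphism `F^gp → P^gp`. -/
noncomputable def faceMap : GrothendieckGroup F →* GrothendieckGroup P :=
  GrothendieckGroup.lift (GrothendieckGroup.of.comp F.subtype)

theorem mem_range_faceMap {x : GrothendieckGroup P} : x ∈ (faceMap F).range ↔
    ∃ a ∈ F, ∃ b ∈ F, x = GrothendieckGroup.of a / GrothendieckGroup.of b := by
  constructor
  · rintro ⟨y, rfl⟩
    obtain ⟨a, b, rfl⟩ := y.exists_eq_div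
    refine ⟨a, a.2, b, b.2, ?_⟩
    rw [map_div, faceMap, GrothendieckGroup.lift_of, GrothendieckGroup.lift_of]
    rfl
  · rintro ⟨a, ha, b, hb, rfl⟩
    refine ⟨GrothendieckGroup.of ⟨a, ha⟩ / GrothendieckGroup.of ⟨b, hb⟩, ?_⟩
    rw [map_div, faceMap, GrothendieckGroup.lift_of, GrothendieckGroup.lift_of]
    rfl

theorem faceMap_injective [IsCancelMul P] : Function.Injective (faceMap F) := by
  rw [injective_iff_map_eq_one]
  intro x hx
  obtain ⟨a, b, rfl⟩ := x.exists_eq_div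
  rw [map_div, div_eq_one, faceMap, GrothendieckGroup.lift_of, GrothendieckGroup.lift_of] at hx
  have : a = b := Subtype.ext (GrothendieckGroup.of_injective hx)
  rw [this, div_self']

variable {F}

/-- If `x ^ n = a / b` with `a, b ∈ F`, then `(x * b) ^ n = a * b ^ (n - 1)` lies in `P`, so `x * b`
is some `p ∈ P` by saturation. A power of `p` lies in the face `F`, hence so does `p`, and `x = p /
b`. This is why `P^gp / F^gp` has no torsion. -/
theorem mem_range_faceMap_of_pow_mem {P : Type u} [CommMonoid P] [IsCancelMul P] {F : Submonoid P}
    (hP : IsSaturatedMonoid P)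
    (hF : ∀ p q : P, p * q ∈ F → p ∈ F) (x : GrothendieckGroup P) (n : ℕ) (hn : 0 < n)
    (hx : x ^ n ∈ (faceMap F).range) : x ∈ (faceMap F).range := by
  obtain ⟨a, ha, b, hb, h⟩ := (mem_range_faceMap F).1 hx
  obtain ⟨n, rfl⟩ := Nat.exists_eq_add_of_lt hn
  have h1 : (x * GrothendieckGroup.of b) ^ (n + 1) = GrothendieckGroup.of (a * b ^ n) := by
    rw [zero_add] at h
    rw [mul_pow, h, map_mul, map_pow, pow_succ']
    rw [← mul_assoc, div_mul_cancel]
  obtain ⟨p, hp⟩ := hP _ (n + 1) (Nat.succ_pos n) ⟨_, h1.symm⟩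
  have h2 : p ^ (n + 1) = a * b ^ n := by
    apply GrothendieckGroup.of_injective
    rw [map_pow, hp, h1]
  have h3 : p ∈ F := hF p (p ^ n) (by
    rw [← pow_succ', h2]
    exact F.mul_mem ha (F.pow_mem hb n))
  exact (mem_range_faceMap F).2 ⟨p, h3, b, hb, by rw [hp, mul_div_cancel_right]⟩

theorem moduleFinite_quotient_faceMap [Monoid.FG P] :
    Module.Finite ℤ (Additive (GrothendieckGroup P ⧸ (faceMap F).range)) := by
  obtain ⟨S, hS⟩ := (Monoid.fg_def (M := P)).1 inferInstance
  have : Group.FG (GrothendieckGroup P) := by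
    classical
    refine Group.fg_iff'.2 ⟨_, S.image GrothendieckGroup.of, rfl, ?_⟩
    rw [_root_.eq_top_iff]
    rintro x -
    have key : ∀ p : P, GrothendieckGroup.of p ∈
        Subgroup.closure (S.image (GrothendieckGroup.of (M := P)) : Set (GrothendieckGroup P)) := by
      intro p
      have hp : p ∈ Submonoid.closure (S : Set P) := hS ▸ Submonoid.mem_top p
      induction hp using Submonoid.closure_induction with
      | mem y hy => exact Subgroup.subset_closure (by simpa using ⟨y, hy, rfl⟩)
      | one => rw [map_one]; exact Subgroup.one_mem _
      | mul y z _ _ hy hz => rw [map_mul]; exact Subgroup.mul_mem _ hy hz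
    obtain ⟨a, b, rfl⟩ := x.exists_eq_div
    exact Subgroup.div_mem _ (key a) (key b)
  have h2 : Group.FG (GrothendieckGroup P ⧸ (faceMap F).range) := QuotientGroup.fg _
  have h3 : AddGroup.FG (Additive (GrothendieckGroup P ⧸ (faceMap F).range)) :=
    GroupFG.iff_add_fg.1 h2
  exact Module.Finite.iff_addGroup_fg.2 h3

theorem isTorsionFree_quotient_faceMap {P : Type u} [CommMonoid P] [IsCancelMul P]
    {F : Submonoid P} (hP : IsSaturatedMonoid P) (hF : ∀ p q : P, p * q ∈ F → p ∈ F) :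
    Module.IsTorsionFree ℤ (Additive (GrothendieckGroup P ⧸ (faceMap F).range)) := by
  refine .of_smul_eq_zero fun n x hx => ?_
  by_contra! h
  obtain ⟨hn, hx0⟩ := h
  obtain ⟨y, rfl⟩ := Additive.ofMul.surjective x
  obtain ⟨z, rfl⟩ := QuotientGroup.mk_surjective y
  have h1 : n.natAbs • Additive.ofMul (z : GrothendieckGroup P ⧸ (faceMap F).range) = 0 := by
    rcases Int.natAbs_eq n with h | h
    · rw [h] at hx
      simpa using hx
    · rw [h] at hx
      simpa using hx
  have h2 : z ^ n.natAbs ∈ (faceMap F).range := by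
    rw [← QuotientGroup.eq_one_iff]
    exact h1
  exact hx0 ((QuotientGroup.eq_one_iff z).2
    (mem_range_faceMap_of_pow_mem hP hF z _ (Int.natAbs_pos.2 hn) h2))

/-- If `F` is a face of a fine and saturated monoid `P`, then `P^gp ≅ F^gp × ℤ^j`. -/
theorem exists_basis_mod_face {P : Type u} [CommMonoid P] [Monoid.FG P] [IsCancelMul P]
    {F : Submonoid P} (hP : IsSaturatedMonoid P) (hF : ∀ p q : P, p * q ∈ F → p ∈ F) {j : ℕ}
    (hj : Module.finrank ℤ (Additive (GrothendieckGroup P ⧸ (faceMap F).range)) = j) :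
    ∃ e : Fin j → GrothendieckGroup P, ∀ (G : Type u) [CommGroup G] (κ : F →* G) (c : Fin j → G),
      ∃! χ : GrothendieckGroup P →* G,
        (∀ q : F, χ (GrothendieckGroup.of (q : P)) = κ q) ∧ ∀ i, χ (e i) = c i := by
  have := moduleFinite_quotient_faceMap (F := F)
  have := isTorsionFree_quotient_faceMap hP hF
  obtain ⟨b⟩ : Nonempty (Module.Basis (Fin j) ℤ
      (Additive (GrothendieckGroup P ⧸ (faceMap F).range))) :=
    ⟨(Module.finBasis ℤ _).reindex (finCongr hj)⟩
  -- The quotient `P^gp / F^gp` is finitely generated and torsion-free over `ℤ`, hence free. The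
  -- witnesses are lifts of a basis.
  choose e he using fun i => QuotientGroup.mk_surjective (Additive.toMul (b i))
  refine ⟨e, fun G _ κ c => ?_⟩
  let s : Additive (GrothendieckGroup P ⧸ (faceMap F).range) →ₗ[ℤ] Additive (GrothendieckGroup P) :=
    b.constr ℤ fun i => Additive.ofMul (e i)
  let s' : (GrothendieckGroup P ⧸ (faceMap F).range) →* GrothendieckGroup P :=
    AddMonoidHom.toMultiplicative s.toAddMonoidHom
  let t : Additive (GrothendieckGroup P ⧸ (faceMap F).range) →ₗ[ℤ] Additive G :=
    b.constr ℤ fun i => Additive.ofMul (c i)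
  let t' : (GrothendieckGroup P ⧸ (faceMap F).range) →* G :=
    AddMonoidHom.toMultiplicative t.toAddMonoidHom
  have hs : ∀ i, s' (e i : GrothendieckGroup P ⧸ (faceMap F).range) = e i := fun i => by
    rw [he]
    exact b.constr_basis ℤ (fun i => Additive.ofMul (e i)) i
  have ht : ∀ i, t' (e i : GrothendieckGroup P ⧸ (faceMap F).range) = c i := fun i => by
    rw [he]
    exact b.constr_basis ℤ (fun i => Additive.ofMul (c i)) i
  have hs2 : ∀ y, (s' y : GrothendieckGroup P ⧸ (faceMap F).range) = y := by
    have : ((MonoidHom.toAdditive (QuotientGroup.mk' (faceMap F).range)).toIntLinearMap).comp s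
        = LinearMap.id := by
      refine b.ext fun i => ?_
      rw [LinearMap.comp_apply, b.constr_basis]
      exact he i
    intro y
    exact LinearMap.congr_fun this (Additive.ofMul y)
  let E : GrothendieckGroup F ≃* (faceMap F).range := MonoidHom.ofInjective (faceMap_injective F)
  -- The section `s'` splits the quotient map, so `x ↦ x / s'(x)` is a retraction of `P^gp` onto the
  -- image of `F^gp`. The extension `χ` uses `κ` on this part and `c` on the quotient.
  let r : GrothendieckGroup P →* (faceMap F).range :=
    (MonoidHom.id _ / s'.comp (QuotientGroup.mk' _)).codRestrict _ fun x => by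
      rw [← QuotientGroup.eq_one_iff]
      have := hs2 x
      simp [this]
  refine ⟨((GrothendieckGroup.lift κ).comp (E.symm.toMonoidHom.comp r)) *
    t'.comp (QuotientGroup.mk' _), ⟨fun q => ?_, fun i => ?_⟩, ?_⟩
  · have h1 : ((GrothendieckGroup.of (q : P) : GrothendieckGroup P) :
        GrothendieckGroup P ⧸ (faceMap F).range) = 1 := by
      rw [QuotientGroup.eq_one_iff, mem_range_faceMap]
      exact ⟨q, q.2, 1, F.one_mem, by simp⟩
    have h2 : r (GrothendieckGroup.of (q : P)) = E (GrothendieckGroup.of q) := by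
      apply Subtype.ext
      have h3 : faceMap F (GrothendieckGroup.of q) = GrothendieckGroup.of (q : P) :=
        GrothendieckGroup.lift_of _ _
      change _ / s' _ = faceMap F (GrothendieckGroup.of q)
      rw [h3]
      refine (congrArg (_ / s' ·) h1).trans ?_
      rw [map_one, div_one]
      rfl
    rw [MonoidHom.mul_apply, MonoidHom.comp_apply, MonoidHom.comp_apply, MonoidHom.comp_apply, h2,
      QuotientGroup.mk'_apply, h1, map_one, mul_one]
    change (GrothendieckGroup.lift κ) (E.symm (E _)) = _
    rw [E.symm_apply_apply, GrothendieckGroup.lift_of]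
  · have h2 : r (e i) = 1 := by
      apply Subtype.ext
      change e i / s' (e i : GrothendieckGroup P ⧸ (faceMap F).range) = 1
      rw [hs, div_self']
    simp only [MonoidHom.mul_apply, MonoidHom.comp_apply, h2, QuotientGroup.mk'_apply, ht, map_one,
      one_mul]
  · rintro χ ⟨h1, h2⟩
    have h3 : χ.comp s' = t' := by
      have : (MonoidHom.toAdditive χ).toIntLinearMap.comp s = t := by
        refine b.ext fun i => ?_
        rw [LinearMap.comp_apply, b.constr_basis, b.constr_basis]
        exact h2 i
      ext y
      exact LinearMap.congr_fun this (Additive.ofMul (QuotientGroup.mk y))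
    have h4 : χ.comp (faceMap F) = GrothendieckGroup.lift κ := by
      apply GrothendieckGroup.lift.symm.injective
      ext q
      change χ (faceMap F (GrothendieckGroup.of q)) =
        GrothendieckGroup.lift κ (GrothendieckGroup.of q)
      rw [GrothendieckGroup.lift_of, ← h1]
      exact congrArg χ (GrothendieckGroup.lift_of _ _)
    refine MonoidHom.ext fun x => ?_
    -- Uniqueness: every `x` is a product of an element of `F^gp` and an element of the image of
    -- `s'`, and `χ` is prescribed on both.
    have h5 : x = faceMap F (E.symm (r x)) * s' x := by
      have h6 : (faceMap F (E.symm (r x))) = (E (E.symm (r x)) : GrothendieckGroup P) := rfl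
      rw [h6, E.apply_symm_apply]
      exact (div_mul_cancel x (s' x)).symm
    conv_lhs => rw [h5, map_mul]
    exact congrArg₂ (· * ·) (DFunLike.congr_fun h4 _) (DFunLike.congr_fun h3 _)

end Face

/-! ### Germs of sections of a log structure -/

namespace LogStructure

variable {X : Scheme.{u}} (L : LogStructure X)

theorem germ_res {U V : X.Opens} (i : U ⟶ V) (x : X) (hx : x ∈ U) (s : L.sec V) :
    L.germ U x hx (L.res i s) = L.germ V x (i.le hx) s := by
  let F := (OpenNhds.inclusion x).op ⋙ L.sheaf.presheaf
  let f : (⟨U, hx⟩ : OpenNhds x) ⟶ ⟨V, i.le hx⟩ := homOfLE i.le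
  have := (CommMonCat.FilteredColimits.colimitCocone.{u, u} F).w f.op
  exact congrArg (fun f => f.hom s) this

theorem exists_germ_eq {x : X} (t : L.stalk x) :
    ∃ (U : X.Opens) (hx : x ∈ U) (s : L.sec U), L.germ U x hx s = t := by
  obtain ⟨⟨j, s⟩, rfl⟩ := Quot.exists_rep t
  exact ⟨j.unop.1, j.unop.2, s, rfl⟩

theorem germ_eq {U V : X.Opens} {x : X} {hU : x ∈ U} {hV : x ∈ V} {s : L.sec U} {t : L.sec V}
    (h : L.germ U x hU s = L.germ V x hV t) :
    ∃ (W : X.Opens) (_ : x ∈ W) (i : W ⟶ U) (j : W ⟶ V), L.res i s = L.res j t := by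
  let F := (OpenNhds.inclusion x).op ⋙ L.sheaf.presheaf
  obtain ⟨k, f, g, h⟩ := (Types.FilteredColimit.isColimit_eq_iff (F ⋙ CategoryTheory.forget _)
    (isColimitOfPreserves (CategoryTheory.forget CommMonCat.{u})
    (CommMonCat.FilteredColimits.colimitCoconeIsColimit.{u, u} F))).1 h
  exact ⟨k.unop.1, k.unop.2, homOfLE f.unop.le, homOfLE g.unop.le, h⟩

/-- The inverse of `α(s)` lifts to some `t`, and `s * t` and `1` are two lifts of the unit `1`,
hence equal. -/
theorem isUnit_of_isUnit_α {U : X.Opens} {s : L.sec U} (h : IsUnit (L.α U s)) : IsUnit s := by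
  obtain ⟨v, hv⟩ := h
  obtain ⟨t, ht, -⟩ := L.existsUnique_of_isUnit U ((v⁻¹ : Γ(X, U)ˣ) : Γ(X, U)) (Units.isUnit _)
  refine IsUnit.of_mul_eq_one t ((L.existsUnique_of_isUnit U 1 isUnit_one).unique ?_ (map_one _))
  rw [map_mul, ← hv, ht, Units.mul_inv]

theorem isUnit_α_iff {U : X.Opens} {s : L.sec U} : IsUnit (L.α U s) ↔ IsUnit s :=
  ⟨L.isUnit_of_isUnit_α, fun h => h.map _⟩

/-- Invertibility of a section of `M` is an open condition, read off from `α`: an inverse of a germ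
exists on a neighbourhood, and conversely `s` is invertible wherever `α(s)` is. -/
theorem isUnit_germ_iff {U : X.Opens} {x : X} (hx : x ∈ U) {s : L.sec U} :
    IsUnit (L.germ U x hx s) ↔ x ∈ X.basicOpen (L.α U s) := by
  constructor
  · intro h
    obtain ⟨v, hv⟩ := h
    obtain ⟨V, hV, t, ht⟩ := L.exists_germ_eq ((v⁻¹ : (L.stalk x)ˣ) : L.stalk x)
    have hUV : x ∈ U ⊓ V := ⟨hx, hV⟩
    have h1 : L.germ (U ⊓ V) x hUV (L.res (homOfLE inf_le_left) s *
        L.res (homOfLE inf_le_right) t) = L.germ (U ⊓ V) x hUV 1 := by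
      rw [map_mul, germ_res, germ_res, ht, ← hv, Units.mul_inv, map_one]
    obtain ⟨W, hxW, i, j, hW⟩ := L.germ_eq h1
    have h2 : IsUnit (L.res (i ≫ homOfLE inf_le_left) s) := by
      rw [map_mul, map_one, res_res, res_res] at hW
      exact IsUnit.of_mul_eq_one _ hW
    have h3 := (L.isUnit_α_iff.2 h2)
    rw [show L.res (i ≫ homOfLE inf_le_left) s = _ from rfl] at h3
    have h4 := L.α_res (i ≫ homOfLE inf_le_left) s
    change IsUnit (L.α W (L.sheaf.presheaf.map (i ≫ homOfLE inf_le_left).op s)) at h3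
    rw [h4] at h3
    rw [Scheme.mem_basicOpen (x := x) (hx := hx)]
    have h5 := h3.map (X.presheaf.germ W x hxW).hom
    rwa [X.presheaf.germ_res_apply] at h5
  · intro h
    have h1 := L.α_res (homOfLE (X.basicOpen_le (L.α U s))) s
    have h2 := RingedSpace.isUnit_res_basicOpen X.toRingedSpace (L.α U s)
    rw [← L.germ_res (homOfLE (X.basicOpen_le (L.α U s))) x h]
    refine IsUnit.map _ (L.isUnit_of_isUnit_α ?_)
    exact h1 ▸ h2

theorem res_isUnit_of_le {U V : X.Opens} (i : V ⟶ U) {s : L.sec U}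
    (h : V ≤ X.basicOpen (L.α U s)) : IsUnit (L.res i s) := by
  apply L.isUnit_of_isUnit_α
  refine (L.α_res i s).symm ▸ ?_
  have h2 := RingedSpace.isUnit_res_basicOpen X.toRingedSpace (L.α U s)
  have h3 := h2.map (X.presheaf.map (homOfLE h).op).hom
  have : X.presheaf.map i.op (L.α U s) = X.presheaf.map (homOfLE h).op
    (X.presheaf.map (homOfLE (X.basicOpen_le (L.α U s))).op (L.α U s)) := by
    rw [← CommRingCat.comp_apply, ← X.presheaf.map_comp]
    rfl
  exact this ▸ h3

theorem IsChart.restrict {L : LogStructure X} {U V : X.Opens} (i : V ⟶ U) {P : Type u}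
    [CommMonoid P] {β : P →* L.sec U} (hβ : L.IsChart U β) :
    L.IsChart V ((L.res i).comp β) where
  surjective x hx s := by
    obtain ⟨p, v, h⟩ := hβ.surjective x (i.le hx) s
    exact ⟨p, v, by rw [MonoidHom.comp_apply, germ_res]; exact h⟩
  injective x hx p p' v v' h := by
    simp only [MonoidHom.comp_apply, germ_res] at h ⊢
    exact hβ.injective x (i.le hx) p p' v v' h

end LogStructure

/-! ### The characteristic monoid and charts -/

namespace LogStructure

variable {X : Scheme.{u}} (L : LogStructure X)

/-- The face of the `p ∈ P` that are units at `x`. -/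
noncomputable def unitFace {U : X.Opens} {P : Type u} [CommMonoid P] (β : P →* L.sec U) (x : X)
    (hx : x ∈ U) : Submonoid P :=
  (IsUnit.submonoid (L.stalk x)).comap ((L.germ U x hx).comp β)

theorem mem_unitFace {U : X.Opens} {P : Type u} [CommMonoid P] {β : P →* L.sec U} {x : X}
    {hx : x ∈ U} {p : P} : p ∈ L.unitFace β x hx ↔ IsUnit (L.germ U x hx (β p)) := Iff.rfl

theorem mem_unitFace_of_mul_mem {U : X.Opens} {P : Type u} [CommMonoid P] {β : P →* L.sec U} {x : X}
    {hx : x ∈ U} (p q : P) (h : p * q ∈ L.unitFace β x hx) : p ∈ L.unitFace β x hx := by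
  rw [mem_unitFace, map_mul, map_mul] at h
  exact isUnit_of_mul_isUnit_left h

open Algebra

variable {L}

/-- The chart makes `P^gp → (M_x / M_x^*)^gp` surjective, and its kernel is `F^gp`. Indeed, if `p /
p'` dies, some multiples `c * p` and `c * p'` have associated germs. The injectivity of the chart
then gives `c * p * q = c * p' * q'` with `q, q' ∈ F`, whence `p / p' = q' / q`. -/
theorem IsChart.rank_eq {U : X.Opens} {P : Type u} [CommMonoid P] {β : P →* L.sec U}
    (hβ : L.IsChart U β) (x : X) (hx : x ∈ U) :
    L.rank x =
      Module.finrank ℤ (Additive (GrothendieckGroup P ⧸ (faceMap (L.unitFace β x hx)).range)) := by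
  let γ : P →* Associates (L.stalk x) := Associates.mkMonoidHom.comp ((L.germ U x hx).comp β)
  have hγ : ∀ p, γ p = Associates.mk (L.germ U x hx (β p)) := fun _ => rfl
  let Φ : GrothendieckGroup P →* GrothendieckGroup (Associates (L.stalk x)) :=
    GrothendieckGroup.lift (GrothendieckGroup.of.comp γ)
  have hΦ : ∀ p, Φ (GrothendieckGroup.of p) = GrothendieckGroup.of (γ p) := fun p =>
    GrothendieckGroup.lift_of _ p
  have hγs : Function.Surjective γ := by
    intro a
    obtain ⟨s, rfl⟩ := Associates.mk_surjective a
    obtain ⟨p, v, rfl⟩ := hβ.surjective x hx s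
    exact ⟨p, Associates.mk_eq_mk_iff_associated.2 ⟨v, rfl⟩⟩
  have hΦs : Function.Surjective Φ := by
    intro y
    obtain ⟨a, b, rfl⟩ := y.exists_eq_div
    obtain ⟨p, rfl⟩ := hγs a
    obtain ⟨q, rfl⟩ := hγs b
    exact ⟨GrothendieckGroup.of p / GrothendieckGroup.of q, by rw [map_div, hΦ, hΦ]⟩
  have hker : Φ.ker = (faceMap (L.unitFace β x hx)).range := by
    ext y
    rw [MonoidHom.mem_ker]
    constructor
    · intro hy
      obtain ⟨p, p', rfl⟩ := y.exists_eq_div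
      rw [map_div, div_eq_one, hΦ, hΦ, GrothendieckGroup.of_eq_of_iff] at hy
      obtain ⟨a, ha⟩ := hy
      obtain ⟨c, rfl⟩ := hγs a
      rw [← map_mul, ← map_mul, hγ, hγ, Associates.mk_eq_mk_iff_associated] at ha
      obtain ⟨v, hv⟩ := ha
      obtain ⟨q, q', hq, hq', h, -⟩ := hβ.injective x hx (c * p) (c * p') v 1 (by
        rw [hv, Units.val_one, mul_one])
      refine (mem_range_faceMap _).2 ⟨q', hq', q, hq, ?_⟩
      have h2 := congrArg (GrothendieckGroup.of (M := P)) h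
      simp only [map_mul, mul_assoc] at h2
      rw [div_eq_div_iff_mul_eq_mul]
      rw [mul_left_cancel h2, mul_comm]
    · intro hy
      obtain ⟨a, ha, b, hb, rfl⟩ := (mem_range_faceMap _).1 hy
      have h1 : ∀ q ∈ L.unitFace β x hx, γ q = 1 := fun q hq => by
        rw [hγ, Associates.mk_eq_one]
        exact hq
      rw [map_div, hΦ, hΦ, h1 a ha, h1 b hb, div_self']
  rw [rank, ← hker]
  exact (LinearEquiv.finrank_eq (MulEquiv.toAdditive
    (QuotientGroup.quotientKerEquivOfSurjective Φ hΦs)).toIntLinearEquiv).symm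

/-- The surjection `P^gp / F_x^gp → P^gp / F_y^gp` goes between groups of the same finite rank. Its
kernel has rank `0`, so it vanishes because the source is torsion-free. An element of `F_y` is then
a quotient of elements of `F_x`, and lies in `F_x` because `F_x` is a face. -/
theorem unitFace_eq_of_le {U : X.Opens} {P : Type u} [CommMonoid P] [Monoid.FG P] [IsCancelMul P]
    (hP : IsSaturatedMonoid P) {β : P →* L.sec U} (hβ : L.IsChart U β) {x y : X} (hx : x ∈ U)
    (hy : y ∈ U) (hxy : L.rank x = L.rank y) (hle : L.unitFace β x hx ≤ L.unitFace β y hy) :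
    L.unitFace β x hx = L.unitFace β y hy := by
  refine le_antisymm hle fun q hq => ?_
  rw [hβ.rank_eq x hx, hβ.rank_eq y hy] at hxy
  set B := (faceMap (L.unitFace β x hx)).range with hB
  set C := (faceMap (L.unitFace β y hy)).range with hC
  have hBC : B ≤ C := by
    intro z hz
    obtain ⟨a, ha, b, hb, rfl⟩ := (mem_range_faceMap _).1 hz
    exact (mem_range_faceMap _).2 ⟨a, hle ha, b, hle hb, rfl⟩
  have := moduleFinite_quotient_faceMap (F := L.unitFace β x hx)
  have := isTorsionFree_quotient_faceMap hP (F := L.unitFace β x hx) L.mem_unitFace_of_mul_mem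
  let f : Additive (GrothendieckGroup P ⧸ B) →ₗ[ℤ] Additive (GrothendieckGroup P ⧸ C) :=
    (MonoidHom.toAdditive (QuotientGroup.map B C (MonoidHom.id _) hBC)).toIntLinearMap
  have hf : Function.Surjective f := by
    intro z
    obtain ⟨z, rfl⟩ := QuotientGroup.mk_surjective (Additive.toMul z)
    exact ⟨Additive.ofMul (z : GrothendieckGroup P ⧸ B), rfl⟩
  have h1 : Module.finrank ℤ (LinearMap.ker f) = 0 := by
    have h2 := Submodule.finrank_quotient_add_finrank (LinearMap.ker f)
    rw [(f.quotKerEquivOfSurjective hf).finrank_eq] at h2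
    change _ + _ = Module.finrank ℤ (Additive (GrothendieckGroup P ⧸ B)) at h2
    omega
  have h3 : LinearMap.ker f = ⊥ := Submodule.finrank_eq_zero.1 h1
  have h4 : (GrothendieckGroup.of q : GrothendieckGroup P) ∈ B := by
    rw [← QuotientGroup.eq_one_iff]
    have h5 : Additive.ofMul ((GrothendieckGroup.of q : GrothendieckGroup P) :
        GrothendieckGroup P ⧸ B) ∈ LinearMap.ker f := by
      rw [LinearMap.mem_ker]
      have : ((GrothendieckGroup.of q : GrothendieckGroup P) : GrothendieckGroup P ⧸ C) = 1 :=
        (QuotientGroup.eq_one_iff _).2 ((mem_range_faceMap _).2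
          ⟨q, hq, 1, Submonoid.one_mem _, by simp⟩)
      exact this
    rw [h3, Submodule.mem_bot] at h5
    exact h5
  obtain ⟨a, ha, b, hb, h⟩ := (mem_range_faceMap _).1 h4
  rw [eq_div_iff_mul_eq', ← map_mul] at h
  have h6 := GrothendieckGroup.of_injective h
  exact L.mem_unitFace_of_mul_mem q b (h6 ▸ ha)

/-- One open set serves all of `F`: it is the locus where the product of the generators lying in `F`
is invertible. Since `F` is a face, every element of `F` is a product of such generators. -/
theorem exists_units_nhds {U : X.Opens} {P : Type u} [CommMonoid P] [Monoid.FG P]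
    (β : P →* L.sec U) (x : X) (hx : x ∈ U) :
    ∃ (V : X.Opens) (_ : x ∈ V) (i : V ⟶ U), ∀ q ∈ L.unitFace β x hx, IsUnit (L.res i (β q)) := by
  classical
  obtain ⟨S, hS⟩ := (Monoid.fg_def (M := P)).1 inferInstance
  let p₀ : P := ∏ s ∈ S with s ∈ L.unitFace β x hx, s
  have hp₀ : p₀ ∈ L.unitFace β x hx := Submonoid.prod_mem _ fun s hs => (Finset.mem_filter.1 hs).2
  let V := X.basicOpen (L.α U (β p₀))
  let i : V ⟶ U := homOfLE (X.basicOpen_le _)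
  refine ⟨V, (L.isUnit_germ_iff hx).1 hp₀, i, fun q hq => ?_⟩
  have hu : IsUnit (L.res i (β p₀)) := L.res_isUnit_of_le i le_rfl
  have hqS : q ∈ Submonoid.closure (S : Set P) := hS ▸ Submonoid.mem_top q
  induction hqS using Submonoid.closure_induction with
  | mem s hs =>
    have hd : s ∣ p₀ := Finset.dvd_prod_of_mem _ (Finset.mem_filter.2 ⟨hs, hq⟩)
    exact isUnit_of_dvd_unit (map_dvd (L.res i) (map_dvd β hd)) hu
  | one => simp
  | mul a b _ _ ha hb =>
    rw [map_mul, map_mul]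
    exact (ha (L.mem_unitFace_of_mul_mem a b hq)).mul
      (hb (L.mem_unitFace_of_mul_mem b a (mul_comm a b ▸ hq)))

variable (L) in
/-- A chart `β : P → M(U)` near a point of the stratum of rank `j`, with the face `F` of the
elements that are units along this stratum and a basis `e` of `P^gp` modulo `F^gp`. -/
structure StratumChart (j : ℕ) where
  U : X.Opens
  (P : Type u)
  [commMonoid : CommMonoid P]
  β : P →* L.sec U
  isChart : L.IsChart U β
  F : Submonoid P
  isUnit (q : P) : q ∈ F → IsUnit (L.α U (β q))
  not_isUnit (x : X) (hx : x ∈ U) (p : P) :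
    L.rank x = j → p ∉ F → ¬ IsUnit (L.germ U x hx (β p))
  e : Fin j → GrothendieckGroup P
  existsUnique (G : Type u) [CommGroup G] (κ : F →* G) (c : Fin j → G) :
    ∃! χ : GrothendieckGroup P →* G,
      (∀ q : F, χ (GrothendieckGroup.of (q : P)) = κ q) ∧ ∀ i, χ (e i) = c i

attribute [instance] StratumChart.commMonoid

/-- The face is taken at `x`, and the chart is shrunk until this face consists of units. At another
point of the same rank the face of units can then only be larger, and equality of ranks forces it to
be the same. So `F` is constant along the stratum. -/
theorem IsFineSaturated.exists_stratumChart (hL : L.IsFineSaturated) (x : X) :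
    ∃ C : L.StratumChart (L.rank x), x ∈ C.U := by
  obtain ⟨U, hx, P, _, β, _, _, hP, hβ⟩ := hL x
  obtain ⟨V, hxV, i, hi⟩ := exists_units_nhds β x hx
  have hF : ∀ y (hy : y ∈ V), L.unitFace ((L.res i).comp β) y hy = L.unitFace β y (i.le hy) := by
    intro y hy
    ext p
    rw [mem_unitFace, mem_unitFace, MonoidHom.comp_apply, germ_res]
  obtain ⟨e, he⟩ := exists_basis_mod_face (F := L.unitFace β x hx) hP L.mem_unitFace_of_mul_mem
    (hβ.rank_eq x hx).symm
  refine ⟨⟨V, P, (L.res i).comp β, hβ.restrict i, L.unitFace β x hx,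
    fun q hq => L.isUnit_α_iff.2 (hi q hq), fun y hy p hr hp => ?_, e, he⟩, hxV⟩
  have hle : L.unitFace β x hx ≤ L.unitFace β y (i.le hy) := fun q hq => by
    rw [← hF y hy]
    exact (hi q hq).map (L.germ V y hy)
  rw [unitFace_eq_of_le hP hβ hx (i.le hy) hr.symm hle, ← hF y hy] at hp
  exact hp

end LogStructure

/-! ### Functions on `T × Spec k[t]/(t^{m+1})` -/

section JetFunctions

variable {k : Type u} [Field k] (m : ℕ)

/-- The class of `t` in `k[t]/(t^{m+1})`. -/
noncomputable def JetRing.gen (k : Type u) [Field k] (m : ℕ) : JetRing k m :=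
  Ideal.Quotient.mk _ Polynomial.X

/-- The basis `1, t, …, t^m` of `k[t]/(t^{m+1})`. -/
noncomputable def JetRing.basis (k : Type u) [Field k] (m : ℕ) :
    Module.Basis (Fin (m + 1)) k (JetRing k m) :=
  let pb := AdjoinRoot.powerBasis' (Polynomial.monic_X_pow (R := k) (m + 1))
  pb.basis.reindex (finCongr (Polynomial.natDegree_X_pow (R := k) (m + 1)))

theorem JetRing.basis_apply (i : Fin (m + 1)) : JetRing.basis k m i = JetRing.gen k m ^ (i : ℕ) := by
  have h := (AdjoinRoot.powerBasis' (Polynomial.monic_X_pow (R := k) (m + 1))).basis.reindex_apply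
    (finCongr (Polynomial.natDegree_X_pow (R := k) (m + 1))) i
  exact h.trans
    ((AdjoinRoot.powerBasis' (Polynomial.monic_X_pow (R := k) (m + 1))).basis_eq_pow _)

/-- `B` is `A ⊗_R S`, and the base change of the basis `t^i` of `S` over `R` is a basis of `B` over
`A`. -/
theorem bijective_sum_pow_of_isPushout {R A S B : Type u} [CommRing R] [CommRing A] [CommRing S]
    [CommRing B] {n : ℕ} [Algebra R S] (b : Module.Basis (Fin n) R S) (t : S)
    (ht : ∀ i, b i = t ^ (i : ℕ)) (f : R →+* A) (g : A →+* B) (h : S →+* B)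
    (H : IsPushout (CommRingCat.ofHom f) (CommRingCat.ofHom (algebraMap R S))
      (CommRingCat.ofHom g) (CommRingCat.ofHom h)) :
    Function.Bijective fun a : Fin n → A => ∑ i, g (a i) * h t ^ (i : ℕ) := by
  let _ := f.toAlgebra
  let _ := g.toAlgebra
  let _ := h.toAlgebra
  let _ := (g.comp f).toAlgebra
  have : IsScalarTower R A B := .of_algebraMap_eq' rfl
  have : IsScalarTower R S B := .of_algebraMap_eq' (congrArg CommRingCat.Hom.hom H.w)
  have H' : Algebra.IsPushout R A S B := CommRingCat.isPushout_iff_isPushout.1 H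
  let b' := H'.out.basis b
  have : (fun a : Fin n → A => ∑ i, g (a i) * h t ^ (i : ℕ)) = b'.equivFun.symm := by
    funext a
    rw [Module.Basis.equivFun_symm_apply]
    refine Finset.sum_congr rfl fun i _ => ?_
    rw [Algebra.smul_def, IsBaseChange.basis_apply, ht, ← map_pow]
    rfl
  rw [this]
  exact b'.equivFun.symm.bijective

variable (T : Over (Spec (CommRingCat.of k)))

/-- The projection `T × Spec k[t]/(t^{m+1}) → Spec k[t]/(t^{m+1})`. -/
noncomputable def thickeningSnd :
    ((thickening m).obj T).left ⟶ Spec (CommRingCat.of (JetRing k m)) :=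
  pullback.snd T.hom (jetStr k m)

theorem isPullback_thickening :
    IsPullback (thickeningProj m T).left (thickeningSnd m T) T.hom (jetStr k m) :=
  IsPullback.of_hasPullback _ _

theorem thickening_map_snd {S T : Over (Spec (CommRingCat.of k))} (u : S ⟶ T) :
    ((thickening m).map u).left ≫ thickeningSnd m T = thickeningSnd m S :=
  pullback.lift_snd _ _ _

theorem thickeningZero_snd : (thickeningZero m T).left ≫ thickeningSnd m T = T.hom ≫ jetZero k m :=
  pullback.lift_snd _ _ _

/-- The function `t` on `T × Spec k[t]/(t^{m+1})`. -/
noncomputable def jetParam : Γ(((thickening m).obj T).left, ⊤) :=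
  (thickeningSnd m T).appTop
    ((Scheme.ΓSpecIso (CommRingCat.of (JetRing k m))).inv (JetRing.gen k m))

theorem thickening_map_jetParam {S T : Over (Spec (CommRingCat.of k))} (u : S ⟶ T) :
    ((thickening m).map u).left.appTop (jetParam m T) = jetParam m S := by
  have := congrArg Scheme.Hom.appTop (thickening_map_snd m u)
  rw [Scheme.Hom.comp_appTop] at this
  exact congrArg (fun f => f.hom ((Scheme.ΓSpecIso (CommRingCat.of (JetRing k m))).inv
    (JetRing.gen k m))) this

theorem thickeningZero_jetParam : (thickeningZero m T).left.appTop (jetParam m T) = 0 := by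
  have := congrArg Scheme.Hom.appTop (thickeningZero_snd m T)
  rw [Scheme.Hom.comp_appTop, Scheme.Hom.comp_appTop] at this
  refine (congrArg (fun f => f.hom ((Scheme.ΓSpecIso (CommRingCat.of (JetRing k m))).inv
    (JetRing.gen k m))) this).trans ?_
  have h2 := Scheme.ΓSpecIso_inv_naturality (CommRingCat.ofHom (JetRing.eval k m))
  have h3 : JetRing.eval k m (JetRing.gen k m) = 0 := by
    change Polynomial.evalRingHom 0 Polynomial.X = 0
    simp
  have h4 := congrArg (fun f => f.hom (JetRing.gen k m)) h2
  refine (congrArg T.hom.appTop h4.symm).trans ?_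
  refine (congrArg (fun x => T.hom.appTop ((Scheme.ΓSpecIso _).inv x)) h3).trans ?_
  simp

/-- The function `∑ aᵢ tⁱ`. -/
noncomputable def jetSum (U : T.left.Opens) (a : Fin (m + 1) → Γ(T.left, U)) :
    Γ(((thickening m).obj T).left, (thickeningProj m T).left ⁻¹ᵁ U) :=
  ∑ i, (thickeningProj m T).left.app U (a i) *
    ((thickening m).obj T).left.presheaf.map (homOfLE le_top).op (jetParam m T) ^ (i : ℕ)

/-- Over an affine `U` the functions on `U × j_m` form the tensor product `Γ(T, U) ⊗_k
k[t]/(t^{m+1})`, which is free over `Γ(T, U)` on the powers of `t`. -/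
theorem jetSum_bijective_of_isAffineOpen {U : T.left.Opens} (hU : IsAffineOpen U) :
    Function.Bijective (jetSum m T U) := by
  have H := isPullback_thickening m T
  have H1 := (isIso_pushoutSection_iff H (US := ⊤) (UT := ⊤) (UX := U)
    (UY := (thickeningProj m T).left ⁻¹ᵁ U) le_top le_top (by simp)).1
    (isIso_pushoutSection_of_isAffineOpen H _ _ _ (isAffineOpen_top _) (isAffineOpen_top _) hU)
  have H2 := H1.of_iso (Scheme.ΓSpecIso (CommRingCat.of k)) (Iso.refl _)
    (Scheme.ΓSpecIso (CommRingCat.of (JetRing k m))) (Iso.refl _)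
    (inl' := (thickeningProj m T).left.app U)
    (inr' := (Scheme.ΓSpecIso (CommRingCat.of (JetRing k m))).inv ≫
      (thickeningSnd m T).appLE ⊤ _ (by simp))
    (f' := (Scheme.ΓSpecIso (CommRingCat.of k)).inv ≫ T.hom.appLE ⊤ U le_top)
    (g' := CommRingCat.ofHom (algebraMap k (JetRing k m)))
    (by simp) (by
      have h : (jetStr k m).appLE ⊤ ⊤ le_top = (jetStr k m).appTop :=
        (Scheme.Hom.app_eq_appLE _).symm
      rw [h]
      exact (Scheme.ΓSpecIso_naturality (CommRingCat.ofHom (algebraMap k (JetRing k m)))))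
    (by simp [Scheme.Hom.app_eq_appLE]) (by simp)
  have H3 := bijective_sum_pow_of_isPushout (JetRing.basis k m) (JetRing.gen k m)
    (JetRing.basis_apply m) _ _ _ H2
  refine Eq.subst (motive := Function.Bijective) (Eq.symm ?_) H3
  funext a
  rw [jetSum]
  refine Finset.sum_congr rfl fun i _ => ?_
  have h5 : (thickeningSnd m T).appTop ≫ ((thickening m).obj T).left.presheaf.map
      (homOfLE le_top).op = (thickeningSnd m T).appLE ⊤ ((thickeningProj m T).left ⁻¹ᵁ U)
        (by simp) := rfl
  exact congrArg (fun f => (thickeningProj m T).left.app U (a i) * f.hom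
    ((Scheme.ΓSpecIso (CommRingCat.of (JetRing k m))).inv (JetRing.gen k m)) ^ (i : ℕ)) h5

theorem jetSum_res {U V : T.left.Opens} (i : V ⟶ U) (a : Fin (m + 1) → Γ(T.left, U)) :
    ((thickening m).obj T).left.presheaf.map
      ((Opens.map (thickeningProj m T).left.base).map i).op (jetSum m T U a) =
      jetSum m T V fun j => T.left.presheaf.map i.op (a j) := by
  rw [jetSum, jetSum, map_sum]
  refine Finset.sum_congr rfl fun j _ => ?_
  rw [map_mul, map_pow]
  refine congrArg₂ (· * · ^ (j : ℕ)) ?_ ?_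
  · exact (app_res (thickeningProj m T).left i (a j)).symm
  · rw [← CommRingCat.comp_apply, ← Functor.map_comp]
    rfl

/-- Both sides are sheaves in `U`, so the affine case suffices: coefficients are compared and glued
over the affine opens contained in `U`. -/
theorem jetSum_bijective (U : T.left.Opens) : Function.Bijective (jetSum m T U) := by
  have hcov : ∀ U : T.left.Opens, U ≤ iSup fun V : {V : T.left.affineOpens // V.1 ≤ U} => V.1.1 := by
    intro U x hx
    obtain ⟨V, hV, hxV, hVU⟩ := Opens.isBasis_iff_nbhd.1 T.left.isBasis_affineOpens hx
    exact Opens.mem_iSup.2 ⟨⟨⟨V, hV⟩, hVU⟩, hxV⟩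
  have hinj : ∀ U, Function.Injective (jetSum m T U) := by
    intro U a b hab
    funext j
    refine T.left.sheaf.eq_of_locally_eq'
      (fun V : {V : T.left.affineOpens // V.1 ≤ U} => V.1.1) U (fun V => homOfLE V.2) (hcov U) _ _
      fun V => ?_
    have h1 := congrArg (((thickening m).obj T).left.presheaf.map
      ((Opens.map (thickeningProj m T).left.base).map (homOfLE V.2)).op) hab
    rw [jetSum_res, jetSum_res] at h1
    exact congrFun ((jetSum_bijective_of_isAffineOpen m T V.1.2).1 h1) j
  refine ⟨hinj U, fun g => ?_⟩
  have h2 : ∀ V : {V : T.left.affineOpens // V.1 ≤ U}, ∃ a, jetSum m T V.1.1 a =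
      ((thickening m).obj T).left.presheaf.map
        ((Opens.map (thickeningProj m T).left.base).map (homOfLE V.2)).op g := fun V =>
    (jetSum_bijective_of_isAffineOpen m T V.1.2).2 _
  choose a ha using h2
  have h3 : ∀ j, ∃! s : Γ(T.left, U), ∀ V : {V : T.left.affineOpens // V.1 ≤ U},
      T.left.presheaf.map (homOfLE V.2).op s = a V j := by
    intro j
    refine T.left.sheaf.existsUnique_gluing'
      (fun V : {V : T.left.affineOpens // V.1 ≤ U} => V.1.1) U (fun V => homOfLE V.2) (hcov U)
      (fun V => a V j) fun V W => ?_
    -- The intersection need not be affine, which is why injectivity is proved for all opens before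
    -- surjectivity.
    refine congrFun (hinj (V.1.1 ⊓ W.1.1)
      (a₁ := fun j => T.left.presheaf.map (Opens.infLELeft _ _).op (a V j))
      (a₂ := fun j => T.left.presheaf.map (Opens.infLERight _ _).op (a W j)) ?_) j
    rw [← jetSum_res, ← jetSum_res, ha, ha, ← CommRingCat.comp_apply, ← Functor.map_comp,
      ← CommRingCat.comp_apply, ← Functor.map_comp]
    rfl
  choose b hb _ using h3
  refine ⟨b, ?_⟩
  refine ((thickening m).obj T).left.sheaf.eq_of_locally_eq'
    (fun V : {V : T.left.affineOpens // V.1 ≤ U} => (thickeningProj m T).left ⁻¹ᵁ V.1.1) _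
    (fun V => (Opens.map (thickeningProj m T).left.base).map (homOfLE V.2)) ?_ _ _ fun V => ?_
  · intro x hx
    obtain ⟨V, hV⟩ := Opens.mem_iSup.1 (hcov U hx)
    exact Opens.mem_iSup.2 ⟨V, hV⟩
  · refine (jetSum_res m T (homOfLE V.2) b).trans (Eq.trans ?_ (ha V))
    exact congrArg _ (funext fun j => hb j V)

end JetFunctions

/-! ### The group of units `1 + a₁ t + ⋯ + a_m t^m` -/

/-- Every point of `W` is of the form `i(y)`, and `g` does not vanish there because its pullback to
`S` is `1`. -/
theorem isUnit_of_mem_oneUnits {S T : Scheme.{u}} (i : S ⟶ T) (hi : Function.Surjective i)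
    {W : T.Opens} {g : Γ(T, W)} (hg : g ∈ oneUnits i W) : IsUnit g := by
  have h : T.basicOpen g = W := by
    refine le_antisymm (T.basicOpen_le g) fun x hx => ?_
    obtain ⟨y, rfl⟩ := hi x
    have h1 : i ⁻¹ᵁ T.basicOpen g = S.basicOpen (i.app W g) := Scheme.preimage_basicOpen i g
    have h2 : y ∈ S.basicOpen (i.app W g) := by
      have h3 : i.app W g = 1 := hg
      rw [h3, Scheme.basicOpen_of_isUnit _ isUnit_one]
      exact hx
    rw [← h1] at h2
    exact h2
  have h4 := RingedSpace.isUnit_res_basicOpen T.toRingedSpace g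
  have h5 := h4.map (T.presheaf.map (homOfLE h.ge).op).hom
  have h6 : T.presheaf.map (homOfLE h.ge).op (T.presheaf.map (homOfLE (T.basicOpen_le g)).op g)
      = g := by
    rw [← CommRingCat.comp_apply, ← T.presheaf.map_comp]
    have : (homOfLE (T.basicOpen_le g)).op ≫ (homOfLE h.ge).op = 𝟙 (op W) := rfl
    rw [this, T.presheaf.map_id]
    rfl
  exact h6 ▸ h5

theorem AlgebraicGeometry.Scheme.presheaf_map_self (X : Scheme.{u}) {U : X.Opens}
    (f : op U ⟶ op U) (a : Γ(X, U)) : X.presheaf.map f a = a := by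
  have : f = 𝟙 _ := Subsingleton.elim _ _
  rw [this, X.presheaf.map_id]
  rfl

section JetUnits

variable {k : Type u} [Field k] (m : ℕ) (T : Over (Spec (CommRingCat.of k)))

/-- The function `∑ aᵢ tⁱ` on `T × Spec k[t]/(t^{m+1})`. -/
noncomputable def jetFun (a : Fin (m + 1) → Γ(T.left, ⊤)) : Γ(((thickening m).obj T).left, ⊤) :=
  ∑ i, (thickeningProj m T).left.appTop (a i) * jetParam m T ^ (i : ℕ)

theorem jetFun_bijective : Function.Bijective (jetFun m T) := by
  have h : jetFun m T = jetSum m T ⊤ := by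
    funext a
    refine Finset.sum_congr rfl fun i _ => ?_
    refine congrArg (fun x => (thickeningProj m T).left.appTop (a i) * x ^ (i : ℕ)) ?_
    exact (Scheme.presheaf_map_self _ _ (jetParam m T)).symm
  rw [h]
  exact jetSum_bijective m T ⊤

theorem thickeningZero_jetFun (a : Fin (m + 1) → Γ(T.left, ⊤)) :
    (thickeningZero m T).left.appTop (jetFun m T a) = a 0 := by
  have h1 : ∀ b : Γ(T.left, ⊤),
      (thickeningZero m T).left.appTop ((thickeningProj m T).left.appTop b) = b := fun b => by
    have h2 := congrArg Scheme.Hom.appTop (thickeningZero_proj m T)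
    rw [Scheme.Hom.comp_appTop, Scheme.Hom.id_appTop] at h2
    exact congrArg (fun f => f.hom b) h2
  rw [jetFun, map_sum, Finset.sum_eq_single 0]
  · rw [map_mul, h1, map_pow]
    simp
  · intro j _ hj
    rw [map_mul, map_pow, thickeningZero_jetParam, zero_pow (fun h => hj (Fin.ext h)),
      mul_zero]
  · exact fun h => absurd (Finset.mem_univ _) h

theorem thickening_map_jetFun {S T : Over (Spec (CommRingCat.of k))} (u : S ⟶ T)
    (a : Fin (m + 1) → Γ(T.left, ⊤)) :
    ((thickening m).map u).left.appTop (jetFun m T a) =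
      jetFun m S fun j => u.left.appTop (a j) := by
  rw [jetFun, jetFun, map_sum]
  refine Finset.sum_congr rfl fun j _ => ?_
  rw [map_mul, map_pow, thickening_map_jetParam]
  refine congrArg (· * jetParam m S ^ (j : ℕ)) ?_
  have h2 := congrArg Scheme.Hom.appTop (LogScheme.thicken_comm' m u)
  rw [Scheme.Hom.comp_appTop, Scheme.Hom.comp_appTop] at h2
  exact congrArg (fun f => f.hom (a j)) h2

/-- The group of units of `T × Spec k[t]/(t^{m+1})` that are equal to `1` for `t = 0`. -/
noncomputable abbrev jetUnits : Subgroup Γ(((thickening m).obj T).left, ⊤)ˣ :=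
  (Units.map ((thickeningZero m T).left.appTop.hom : _ →* Γ(T.left, ⊤))).ker

variable {m T} in
theorem mem_jetUnits {g : Γ(((thickening m).obj T).left, ⊤)ˣ} :
    g ∈ jetUnits m T ↔ (thickeningZero m T).left.appTop g = 1 := by
  rw [MonoidHom.mem_ker, Units.ext_iff]
  rfl

/-- The unit `1 + a₁ t + ⋯ + a_m t^m`. -/
noncomputable def jetUnitOf (a : Fin m → Γ(T.left, ⊤)) : jetUnits m T :=
  have h : (thickeningZero m T).left.appTop (jetFun m T (Fin.cons 1 a)) = 1 :=
    thickeningZero_jetFun m T (Fin.cons 1 a)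
  ⟨(isUnit_of_mem_oneUnits (thickeningZero m T).left (thickeningZero_surjective m T)
    (W := ⊤) (g := jetFun m T (Fin.cons 1 a)) h).unit, mem_jetUnits.2 h⟩

theorem jetUnitOf_val (a : Fin m → Γ(T.left, ⊤)) :
    ((jetUnitOf m T a).1 : Γ(((thickening m).obj T).left, ⊤)) = jetFun m T (Fin.cons 1 a) := rfl

/-- As a functor in `T`, the group of units is affine `m`-space: the coefficients of a function are
unique, and the condition at `t = 0` says that the constant one is `1`. The group law plays no role
for the coordinates. -/
theorem jetUnitOf_bijective : Function.Bijective (jetUnitOf m T) := by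
  constructor
  · intro a b hab
    have h1 : jetFun m T (Fin.cons 1 a) = jetFun m T (Fin.cons 1 b) :=
      congrArg (fun g : jetUnits m T => (g.1 : Γ(((thickening m).obj T).left, ⊤))) hab
    have h2 := (jetFun_bijective m T).1 h1
    funext i
    have := congrFun h2 i.succ
    simpa using this
  · intro g
    obtain ⟨b, hb⟩ := (jetFun_bijective m T).2 (g.1 : Γ(((thickening m).obj T).left, ⊤))
    refine ⟨fun i => b i.succ, Subtype.ext (Units.ext ?_)⟩
    rw [jetUnitOf_val]
    refine Eq.trans (congrArg _ ?_) hb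
    have h0 : b 0 = 1 := by
      rw [← thickeningZero_jetFun m T b, ← mem_jetUnits.1 g.2]
      exact congrArg _ hb
    rw [← h0]
    exact Fin.cons_self_tail b

variable {m} in
/-- Pullback of units along `S → T`. -/
noncomputable def jetUnitsMap {S T : Over (Spec (CommRingCat.of k))} (u : S ⟶ T) :
    jetUnits m T →* jetUnits m S :=
  ((Units.map (((thickening m).map u).left.appTop.hom : _ →* _)).comp
    (jetUnits m T).subtype).codRestrict _ fun g => by
      rw [mem_jetUnits]
      have h2 := congrArg Scheme.Hom.appTop (LogScheme.thicken_comm m u)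
      rw [Scheme.Hom.comp_appTop, Scheme.Hom.comp_appTop] at h2
      refine (congrArg (fun f => f.hom (g.1 : Γ(((thickening m).obj T).left, ⊤))) h2).trans ?_
      refine (congrArg u.left.appTop (mem_jetUnits.1 g.2)).trans ?_
      exact map_one _

theorem jetUnitsMap_jetUnitOf {S T : Over (Spec (CommRingCat.of k))} (u : S ⟶ T)
    (a : Fin m → Γ(T.left, ⊤)) :
    jetUnitsMap u (jetUnitOf m T a) = jetUnitOf m S fun i => u.left.appTop (a i) := by
  refine Subtype.ext (Units.ext ?_)
  rw [jetUnitOf_val]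
  refine (thickening_map_jetFun m u _).trans (congrArg _ ?_)
  funext j
  refine Fin.cases ?_ (fun i => ?_) j
  · simp
  · simp

end JetUnits

/-! ### Extending homomorphisms from a chart to the log structure -/

/-- The algebra behind `IsTwist.unique`. There `bv`, `av`, `xp` stand for `b(v)`, `a(v)`, `χ(p)`,
and similarly for the other letters; the common factor in the conclusion is a unit. -/
theorem twist_unique_aux {R : Type*} [CommRing R] {g g' bv av bv' av' bq bq' xp xp' xq xq' : R}
    (h : g * bv = xp * av) (h' : g' * bv' = xp' * av') (e1 : xp * xq = xp' * xq')
    (e2 : av * (bq' * xq') = av' * (bq * xq)) (e3 : bv * bq' = bv' * bq) :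
    g * (bv * bv' * bq * bq' * (xq * xq')) = g' * (bv * bv' * bq * bq' * (xq * xq')) := by
  linear_combination (bv' * bq * bq' * xq * xq') * h + (av * bq' * xq' * bv' * bq) * e1 +
    (xp' * xq' * bv' * bq) * e2 - (bq * xq * xq' * bv' * bq) * h' - (g' * bv' * xq * xq' * bq) * e3

section Extend

variable {S T X : Scheme.{u}} {L : LogStructure X} {φ : T ⟶ X}

/-- A family of homomorphisms `M(V) → 𝒪_T(φ⁻¹ V)` is compatible with restriction. -/
def IsResCompatible (f : ∀ V : X.Opens, L.sec V →* Γ(T, φ ⁻¹ᵁ V)) : Prop :=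
  ∀ {U V : X.Opens} (i : U ⟶ V) (s : L.sec V),
    f U (L.res i s) = T.presheaf.map ((Opens.map φ.base).map i).op (f V s)

variable {f : ∀ V : X.Opens, L.sec V →* Γ(T, φ ⁻¹ᵁ V)} (hf : IsResCompatible f)

/-- The homomorphism on stalks induced by a family of homomorphisms `M(V) → 𝒪_T(φ⁻¹ V)`. -/
noncomputable def IsResCompatible.stalk (y : T) : L.stalk (φ y) →* T.presheaf.stalk y :=
  ((CommMonCat.FilteredColimits.colimitCoconeIsColimit.{u, u}
    ((OpenNhds.inclusion (φ y)).op ⋙ L.sheaf.presheaf)).desc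
    { pt := CommMonCat.of (T.presheaf.stalk y)
      ι :=
        { app V := CommMonCat.ofHom <|
            ((T.presheaf.germ (φ ⁻¹ᵁ V.unop.1) y V.unop.2).hom : _ →* _).comp (f V.unop.1)
          naturality V W j := by
            ext s
            refine (congrArg (T.presheaf.germ (φ ⁻¹ᵁ W.unop.1) y W.unop.2)
              (hf (homOfLE j.unop.le) s)).trans ?_
            exact T.presheaf.germ_res_apply _ _ _ _ } }).hom

theorem IsResCompatible.stalk_germ (y : T) (V : X.Opens) (hV : φ y ∈ V) (s : L.sec V) :
    hf.stalk y (L.germ V (φ y) hV s) = T.presheaf.germ (φ ⁻¹ᵁ V) y hV (f V s) := by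
  have := (CommMonCat.FilteredColimits.colimitCoconeIsColimit.{u, u}
    ((OpenNhds.inclusion (φ y)).op ⋙ L.sheaf.presheaf)).fac
    { pt := CommMonCat.of (T.presheaf.stalk y)
      ι :=
        { app V := CommMonCat.ofHom <|
            ((T.presheaf.germ (φ ⁻¹ᵁ V.unop.1) y V.unop.2).hom : _ →* _).comp (f V.unop.1)
          naturality V W j := by
            ext s
            refine (congrArg (T.presheaf.germ (φ ⁻¹ᵁ W.unop.1) y W.unop.2)
              (hf (homOfLE j.unop.le) s)).trans ?_
            exact T.presheaf.germ_res_apply _ _ _ _ } } (op ⟨V, hV⟩)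
  exact congrArg (fun f => f.hom s) this

theorem section_ext_germ {V : T.Opens} {g g' : Γ(T, V)}
    (h : ∀ y (hy : y ∈ V), T.presheaf.germ V y hy g = T.presheaf.germ V y hy g') : g = g' :=
  TopCat.Presheaf.section_ext T.sheaf V g g' h

variable {i : S ⟶ T} {a b : ∀ V : X.Opens, L.sec V →* Γ(T, φ ⁻¹ᵁ V)}
  {ha : IsResCompatible a} {hb : IsResCompatible b}

/-- Families `g` with `a = b * g` are determined by their values on a chart. -/
theorem eq_of_eq_on_chart (hb : IsResCompatible b) {g g' : ∀ V : X.Opens, L.sec V →* Γ(T, φ ⁻¹ᵁ V)}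
    (hg : IsResCompatible g) (hg' : IsResCompatible g') (hag : ∀ V s, a V s = b V s * g V s)
    (hag' : ∀ V s, a V s = b V s * g' V s) {U : X.Opens} {P : Type u} [CommMonoid P]
    {β : P →* L.sec U} (hβ : L.IsChart U β) (hφ : ∀ y, φ y ∈ U)
    (h : ∀ p, g U (β p) = g' U (β p)) : g = g' := by
  have key : ∀ y, hg.stalk y = hg'.stalk y := by
    intro y
    have h1 : ∀ s, hb.stalk y s * hg.stalk y s = hb.stalk y s * hg'.stalk y s := by
      intro s
      obtain ⟨V, hV, s, rfl⟩ := L.exists_germ_eq s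
      rw [hg.stalk_germ, hg'.stalk_germ, hb.stalk_germ, ← map_mul, ← map_mul, ← hag, ← hag']
    ext s
    -- Each germ is a chart element times a unit `v`. On the chart the values agree by assumption,
    -- and at `v` the equation `a = b * g` determines `g(v)` because `b(v)` is invertible.
    obtain ⟨p, v, rfl⟩ := hβ.surjective (φ y) (hφ y) s
    rw [map_mul, map_mul, hg.stalk_germ, hg'.stalk_germ, h]
    exact congrArg (_ * ·) ((v.isUnit.map (hb.stalk y)).mul_left_cancel (h1 v))
  funext V
  ext s
  refine section_ext_germ fun y hy => ?_
  have hy' : φ y ∈ V := hy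
  have := DFunLike.congr_fun (key y) (L.germ V (φ y) hy' s)
  rwa [hg.stalk_germ, hg'.stalk_germ] at this

variable (ha hb) in
/-- The relation `g = χ(p) a(v) / b(v)` between sections `s` and `g`, where `s = β(p) v` locally. -/
def IsTwist {U : X.Opens} {P : Type u} [CommMonoid P] (β : P →* L.sec U) (hφ : ∀ y, φ y ∈ U)
    (χ : P →* Γ(T, ⊤)) {V : X.Opens} (s : L.sec V) {W : T.Opens} (hW : W ≤ φ ⁻¹ᵁ V)
    (g : Γ(T, W)) : Prop :=
  ∀ y (hy : y ∈ W), ∃ (p : P) (v : (L.stalk (φ y))ˣ),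
    L.germ V (φ y) (hW hy) s = L.germ U (φ y) (hφ y) (β p) * v ∧
    T.presheaf.germ W y hy g * hb.stalk y v = T.presheaf.germ ⊤ y trivial (χ p) * ha.stalk y v

variable {U : X.Opens} {P : Type u} [CommMonoid P] {β : P →* L.sec U} {hφ : ∀ y, φ y ∈ U}
    {χ : P →* Γ(T, ⊤)}

/-- Independence of the decomposition `s = β(p) v`. Two decompositions differ by elements `q, q'`
that become units, and for these `χ = a / b` on stalks, so the change in `χ(p)` cancels the change
in `a(v) / b(v)`. -/
theorem IsTwist.unique (hβ : L.IsChart U β)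
    (hχ : ∀ p, a U (β p) = b U (β p) * T.presheaf.map (homOfLE le_top).op (χ p))
    (hu : ∀ p, IsUnit (χ p))
    {V : X.Opens} {s : L.sec V} {W : T.Opens} {hW : W ≤ φ ⁻¹ᵁ V} {g g' : Γ(T, W)}
    (h : IsTwist ha hb β hφ χ s hW g) (h' : IsTwist ha hb β hφ χ s hW g') : g = g' := by
  refine section_ext_germ fun y hy => ?_
  obtain ⟨p, v, h1, h2⟩ := h y hy
  obtain ⟨p', v', h1', h2'⟩ := h' y hy
  have hχ' : ∀ p, ha.stalk y (L.germ U (φ y) (hφ y) (β p)) =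
      hb.stalk y (L.germ U (φ y) (hφ y) (β p)) * T.presheaf.germ ⊤ y trivial (χ p) := by
    intro p
    rw [ha.stalk_germ, hb.stalk_germ, hχ, map_mul]
    exact congrArg (_ * ·) (T.presheaf.germ_res_apply _ _ _ _)
  obtain ⟨q, q', hq, hq', hp, hv⟩ := hβ.injective (φ y) (hφ y) p p' v v' (h1.symm.trans h1')
  have e1 := congrArg (fun p => T.presheaf.germ ⊤ y trivial (χ p)) hp
  have e2 := congrArg (ha.stalk y) hv
  have e3 := congrArg (hb.stalk y) hv
  have e4 := hχ' q
  have e5 := hχ' q'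
  have u1 := v.isUnit.map (hb.stalk y)
  have u2 := v'.isUnit.map (hb.stalk y)
  have u3 := hq.map (hb.stalk y)
  have u4 := hq'.map (hb.stalk y)
  have u5 := (hu q).map (T.presheaf.germ ⊤ y trivial).hom
  have u6 := (hu q').map (T.presheaf.germ ⊤ y trivial).hom
  simp only [map_mul] at e1 e2 e3
  rw [e4, e5] at e2
  refine ((((u1.mul u2).mul u3).mul u4).mul (u5.mul u6)).mul_right_cancel ?_
  exact twist_unique_aux h2 h2' e1 e2 e3

theorem IsTwist.map {V V' : X.Opens} {s : L.sec V} {W W' : T.Opens} {hW : W ≤ φ ⁻¹ᵁ V}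
    {g : Γ(T, W)} (h : IsTwist ha hb β hφ χ s hW g) (j : V' ⟶ V) (j' : W' ⟶ W)
    (hW' : W' ≤ φ ⁻¹ᵁ V') :
    IsTwist ha hb β hφ χ (L.res j s) hW' (T.presheaf.map j'.op g) := by
  intro y hy
  obtain ⟨p, v, h1, h2⟩ := h y (j'.le hy)
  refine ⟨p, v, ?_, ?_⟩
  · rw [← h1]
    exact L.germ_res j (φ y) (hW' hy) s
  · rw [← h2]
    exact congrArg (· * _) (T.presheaf.germ_res_apply _ _ _ _)

theorem IsTwist.mul {V : X.Opens} {s s' : L.sec V} {W : T.Opens} {hW : W ≤ φ ⁻¹ᵁ V}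
    {g g' : Γ(T, W)} (h : IsTwist ha hb β hφ χ s hW g) (h' : IsTwist ha hb β hφ χ s' hW g') :
    IsTwist ha hb β hφ χ (s * s') hW (g * g') := by
  intro y hy
  obtain ⟨p, v, h1, h2⟩ := h y hy
  obtain ⟨p', v', h1', h2'⟩ := h' y hy
  refine ⟨p * p', v * v', ?_, ?_⟩
  · rw [map_mul, h1, h1', map_mul, map_mul, Units.val_mul]
    exact mul_mul_mul_comm _ _ _ _
  · rw [map_mul, Units.val_mul, map_mul, map_mul, map_mul, map_mul, mul_mul_mul_comm, h2, h2',
      mul_mul_mul_comm]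

theorem isTwist_one {V : X.Opens} {W : T.Opens} {hW : W ≤ φ ⁻¹ᵁ V} :
    IsTwist ha hb β hφ χ (1 : L.sec V) hW 1 := by
  intro y hy
  refine ⟨1, 1, ?_, ?_⟩
  · simp
  · simp

theorem isTwist_chart (p : P) :
    IsTwist ha hb β hφ χ (β p) le_rfl (T.presheaf.map (homOfLE le_top).op (χ p)) := by
  intro y hy
  refine ⟨p, 1, ?_, ?_⟩
  · rw [Units.val_one, mul_one]
  · rw [Units.val_one, map_one, map_one]
    exact congrArg (· * 1) (T.presheaf.germ_res_apply _ _ _ _)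

theorem IsTwist.eq_mul (hχ : ∀ p, a U (β p) = b U (β p) * T.presheaf.map (homOfLE le_top).op (χ p))
    {V : X.Opens} {s : L.sec V} {g : Γ(T, φ ⁻¹ᵁ V)} (h : IsTwist ha hb β hφ χ s le_rfl g) :
    a V s = b V s * g := by
  refine section_ext_germ fun y hy => ?_
  have hy' : φ y ∈ V := hy
  obtain ⟨p, v, h1, h2⟩ := h y hy
  have hχ' : ha.stalk y (L.germ U (φ y) (hφ y) (β p)) =
      hb.stalk y (L.germ U (φ y) (hφ y) (β p)) * T.presheaf.germ ⊤ y trivial (χ p) := by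
    rw [ha.stalk_germ, hb.stalk_germ, hχ, map_mul]
    exact congrArg (_ * ·) (T.presheaf.germ_res_apply _ _ _ _)
  rw [map_mul, ← ha.stalk_germ y V hy', ← hb.stalk_germ y V hy', h1, map_mul, map_mul, hχ']
  rw [mul_assoc, mul_assoc, ← h2]
  exact congrArg (_ * ·) (mul_comm _ _)

/-- After pullback along `i` the families `a` and `b` agree and `χ(p)` becomes `1`, so the relation
reads `i^♯(g) b(v) = b(v)` with `b(v)` invertible. -/
theorem IsTwist.mem_oneUnits
    (hab : ∀ V s, i.app (φ ⁻¹ᵁ V) (a V s) = i.app (φ ⁻¹ᵁ V) (b V s))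
    (hχ1 : ∀ p, χ p ∈ oneUnits i ⊤)
    {V : X.Opens} {s : L.sec V} {g : Γ(T, φ ⁻¹ᵁ V)} (h : IsTwist ha hb β hφ χ s le_rfl g) :
    g ∈ oneUnits i (φ ⁻¹ᵁ V) := by
  change i.app _ g = 1
  refine section_ext_germ fun z hz => ?_
  obtain ⟨p, v, -, h2⟩ := h (i z) hz
  have e1 : ∀ t, (i.stalkMap z) (ha.stalk (i z) t) = (i.stalkMap z) (hb.stalk (i z) t) := by
    intro t
    obtain ⟨V, hV, t, rfl⟩ := L.exists_germ_eq t
    rw [ha.stalk_germ, hb.stalk_germ]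
    refine (Scheme.Hom.germ_stalkMap_apply i (φ ⁻¹ᵁ V) z hV _).trans ?_
    rw [hab]
    exact (Scheme.Hom.germ_stalkMap_apply i (φ ⁻¹ᵁ V) z hV _).symm
  have e2 : (i.stalkMap z) (T.presheaf.germ ⊤ (i z) trivial (χ p)) = 1 := by
    refine (Scheme.Hom.germ_stalkMap_apply i ⊤ z trivial _).trans ?_
    have : i.app ⊤ (χ p) = 1 := hχ1 p
    rw [this, map_one]
  have e3 := congrArg (i.stalkMap z) h2
  rw [map_mul, map_mul, e2, one_mul, e1] at e3
  have u1 := (v.isUnit.map (hb.stalk (i z))).map (i.stalkMap z).hom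
  have e4 := u1.mul_right_cancel (e3.trans (one_mul _).symm)
  rw [map_one]
  exact (Scheme.Hom.germ_stalkMap_apply i (φ ⁻¹ᵁ V) z hz g).symm.trans e4

/-- A decomposition of the germ of `s` as `β(p) w` with `w` a unit persists on a neighbourhood `N`
in `X`, and there `χ(p) a(w) / b(w)` is a solution. -/
theorem exists_isTwist_nhds (hβ : L.IsChart U β) {V : X.Opens} (s : L.sec V) (y : T)
    (hy : φ y ∈ V) :
    ∃ (N : X.Opens) (_ : φ y ∈ N) (j : N ⟶ V) (g : Γ(T, φ ⁻¹ᵁ N)),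
      IsTwist ha hb β hφ χ (L.res j s) le_rfl g := by
  obtain ⟨p, v, h⟩ := hβ.surjective (φ y) (hφ y) (L.germ V (φ y) hy s)
  obtain ⟨N₁, hN₁, w, hw⟩ := L.exists_germ_eq (v : L.stalk (φ y))
  have hB : φ y ∈ X.basicOpen (L.α N₁ w) := (L.isUnit_germ_iff hN₁).1 (hw ▸ v.isUnit)
  have hUB : φ y ∈ U ⊓ X.basicOpen (L.α N₁ w) := ⟨hφ y, hB⟩
  let j₁ : U ⊓ X.basicOpen (L.α N₁ w) ⟶ U := homOfLE inf_le_left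
  let j₂ : U ⊓ X.basicOpen (L.α N₁ w) ⟶ N₁ := homOfLE (inf_le_right.trans (X.basicOpen_le _))
  have h1 : L.germ V (φ y) hy s = L.germ _ (φ y) hUB (L.res j₁ (β p) * L.res j₂ w) := by
    rw [map_mul, L.germ_res, L.germ_res, hw, h]
  obtain ⟨N, hN, jV, j₃, hj⟩ := L.germ_eq h1
  have hwu : IsUnit (L.res (j₃ ≫ j₂) w) :=
    L.res_isUnit_of_le _ (j₃.le.trans inf_le_right)
  obtain ⟨w', hw'⟩ := hwu
  have hj' : L.res jV s = L.res (j₃ ≫ j₁) (β p) * w' := by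
    rw [hj, hw', map_mul, L.res_res, L.res_res]
  obtain ⟨c, hc⟩ := (w'.isUnit.map (b N))
  refine ⟨N, hN, jV, T.presheaf.map (homOfLE le_top).op (χ p) * a N w' *
    ((c⁻¹ : Γ(T, φ ⁻¹ᵁ N)ˣ) : Γ(T, φ ⁻¹ᵁ N)), fun z hz => ?_⟩
  have hz' : φ z ∈ N := hz
  refine ⟨p, Units.map (L.germ N (φ z) hz') w', ?_, ?_⟩
  · rw [hj', map_mul]
    exact congrArg (· * _) (L.germ_res (j₃ ≫ j₁) (φ z) hz' (β p))
  · rw [Units.coe_map, hb.stalk_germ, ha.stalk_germ, ← map_mul, mul_assoc, ← hc,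
      Units.inv_mul, mul_one, map_mul]
    exact congrArg (· * _) (T.presheaf.germ_res_apply _ _ _ _)

/-- Local solutions agree on overlaps by `IsTwist.unique`, so they glue. -/
theorem existsUnique_isTwist (hβ : L.IsChart U β)
    (hχ : ∀ p, a U (β p) = b U (β p) * T.presheaf.map (homOfLE le_top).op (χ p))
    (hu : ∀ p, IsUnit (χ p)) {V : X.Opens} (s : L.sec V) :
    ∃! g : Γ(T, φ ⁻¹ᵁ V), IsTwist ha hb β hφ χ s le_rfl g := by
  choose N hN j g hg using fun y : φ ⁻¹ᵁ V => exists_isTwist_nhds (ha := ha) (hb := hb) (hφ := hφ)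
    (χ := χ) hβ s y.1 y.2
  have hcov : φ ⁻¹ᵁ V ≤ iSup fun y => φ ⁻¹ᵁ (N y) := fun y hy =>
    Opens.mem_iSup.2 ⟨⟨y, hy⟩, hN ⟨y, hy⟩⟩
  obtain ⟨G, hG, -⟩ := T.sheaf.existsUnique_gluing' (fun y => φ ⁻¹ᵁ (N y)) (φ ⁻¹ᵁ V)
    (fun y => (Opens.map φ.base).map (j y)) hcov g (fun y z => by
      have h1 := (hg y).map (homOfLE inf_le_left : N y ⊓ N z ⟶ N y)
        (Opens.infLELeft (φ ⁻¹ᵁ (N y)) (φ ⁻¹ᵁ (N z))) le_rfl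
      have h2 := (hg z).map (homOfLE inf_le_right : N y ⊓ N z ⟶ N z)
        (Opens.infLERight (φ ⁻¹ᵁ (N y)) (φ ⁻¹ᵁ (N z))) le_rfl
      rw [L.res_res] at h1 h2
      exact h1.unique hβ hχ hu h2)
  have hG' : IsTwist ha hb β hφ χ s le_rfl G := by
    intro y hy
    obtain ⟨p, v, h1, h2⟩ := hg ⟨y, hy⟩ y (hN ⟨y, hy⟩)
    refine ⟨p, v, ?_, ?_⟩
    · rw [← h1]
      exact (L.germ_res _ _ _ _).symm
    · rw [← h2]
      refine congrArg (· * _) ?_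
      refine Eq.trans ?_ (congrArg (T.presheaf.germ _ y (hN ⟨y, hy⟩)) (hG ⟨y, hy⟩))
      exact (T.presheaf.germ_res_apply _ _ _ _).symm
  exact ⟨G, hG', fun G' h => h.unique hβ hχ hu hG'⟩

/-- A homomorphism on a chart with `a = b * χ` extends to a family `g` with `a = b * g`. -/
theorem exists_extension (ha : IsResCompatible a) (hb : IsResCompatible b) (hβ : L.IsChart U β)
    (hφ : ∀ y, φ y ∈ U) (hi : Function.Surjective i)
    (hab : ∀ V s, i.app (φ ⁻¹ᵁ V) (a V s) = i.app (φ ⁻¹ᵁ V) (b V s))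
    (hχ1 : ∀ p, χ p ∈ oneUnits i ⊤)
    (hχ : ∀ p, a U (β p) = b U (β p) * T.presheaf.map (homOfLE le_top).op (χ p)) :
    ∃ g : ∀ V : X.Opens, L.sec V →* Γ(T, φ ⁻¹ᵁ V), IsResCompatible g ∧
      (∀ V s, a V s = b V s * g V s) ∧ (∀ V s, g V s ∈ oneUnits i (φ ⁻¹ᵁ V)) ∧
      ∀ p, g U (β p) = T.presheaf.map (homOfLE le_top).op (χ p) := by
  have hu : ∀ p, IsUnit (χ p) := fun p => isUnit_of_mem_oneUnits i hi (hχ1 p)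
  choose g hg hg' using fun (V : X.Opens) (s : L.sec V) =>
    existsUnique_isTwist (ha := ha) (hb := hb) (hφ := hφ) hβ hχ hu s
  -- Multiplicativity, compatibility with restriction and the values on the chart all follow from
  -- uniqueness, because `IsTwist` is stable under these operations.
  refine ⟨fun V => ⟨⟨g V, (hg' V 1 1 isTwist_one).symm⟩, fun s s' =>
    (hg' V _ _ ((hg V s).mul (hg V s'))).symm⟩, fun {V W} j s => ?_, fun V s => ?_, fun V s => ?_,
    fun p => ?_⟩
  · exact (hg' V _ _ ((hg W s).map j ((Opens.map φ.base).map j) le_rfl)).symm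
  · exact (hg V s).eq_mul hχ
  · exact (hg V s).mem_oneUnits hab hχ1
  · exact (hg' U _ _ (isTwist_chart p)).symm

end Extend

/-! ### Log jets over schemes with the log structure `𝒪 → 𝒪` -/

theorem AlgebraicGeometry.Scheme.presheaf_map_map_self (X : Scheme.{u}) {U V : X.Opens}
    (f : op U ⟶ op V) (g : op V ⟶ op U) (a : Γ(X, U)) :
    X.presheaf.map g (X.presheaf.map f a) = a := by
  rw [← CommRingCat.comp_apply, ← Functor.map_comp]
  exact X.presheaf_map_self _ a

section ConstPart

variable {S T : Scheme.{u}} (i : S ⟶ T) (p : T ⟶ S) (hip : i ≫ p = 𝟙 S)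
  (hi : Function.Surjective i)

/-- The endomorphism `g ↦ p^♯ i^♯ g` of functions on `T`. -/
noncomputable def constPart (W : T.Opens) : Γ(T, W) →+* Γ(T, W) :=
  (p.appLE (i ⁻¹ᵁ W) W (le_preimage_preimage i p hip hi W)).hom.comp (i.app W).hom

theorem constPart_res {V W : T.Opens} (j : V ⟶ W) (g : Γ(T, W)) :
    constPart i p hip hi V (T.presheaf.map j.op g) =
      T.presheaf.map j.op (constPart i p hip hi W g) := by
  refine (congrArg (p.appLE (i ⁻¹ᵁ V) V (le_preimage_preimage i p hip hi V))
    (app_res i j g)).trans ?_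
  have h : S.presheaf.map ((Opens.map i.base).map j).op ≫
      p.appLE (i ⁻¹ᵁ V) V (le_preimage_preimage i p hip hi V) =
      p.appLE (i ⁻¹ᵁ W) W (le_preimage_preimage i p hip hi W) ≫ T.presheaf.map j.op := by
    rw [Scheme.Hom.appLE_map, Scheme.Hom.map_appLE]
  exact congrArg (fun f => f.hom (i.app W g)) h

theorem app_constPart (W : T.Opens) (g : Γ(T, W)) : i.app W (constPart i p hip hi W g) = i.app W g :=
  app_appLE_apply i p hip W _ _

end ConstPart

/-- The sheaf of functions as a presheaf of monoids. -/
noncomputable def multPresheaf (X : Scheme.{u}) : TopCat.Presheaf CommMonCat.{u} X where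
  obj U := CommMonCat.of Γ(X, U.unop)
  map f := CommMonCat.ofHom ((X.presheaf.map f).hom : _ →* _)
  map_id U := by
    ext s
    exact X.presheaf_map_self _ s
  map_comp f g := by
    ext s
    exact congrArg (fun f => f.hom s) (X.presheaf.map_comp f g)

theorem multPresheaf_isSheaf (X : Scheme.{u}) : (multPresheaf X).IsSheaf := by
  rw [TopCat.Presheaf.isSheaf_iff_isSheaf_comp (CategoryTheory.forget CommMonCat)]
  exact (TopCat.Presheaf.isSheaf_iff_isSheaf_comp (CategoryTheory.forget CommRingCat) _).1
    X.sheaf.property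

/-- The log structure `𝒪 → 𝒪`. -/
noncomputable def LogStructure.ofFunctions (X : Scheme.{u}) : LogStructure X where
  sheaf := ⟨multPresheaf X, multPresheaf_isSheaf X⟩
  α U := MonoidHom.id Γ(X, U)
  α_res _ _ := rfl
  existsUnique_of_isUnit _ u _ := ⟨u, rfl, fun _ h => h⟩

namespace LogScheme

variable {k : Type u} [Field k]

/-- A `k`-scheme with the log structure `𝒪 → 𝒪`. -/
noncomputable def ofScheme (T : Over (Spec (CommRingCat.of k))) : LogScheme k where
  toOver := T
  log := LogStructure.ofFunctions T.left

/-- The morphism of log schemes from `T` with the log structure `𝒪 → 𝒪` induced by a morphism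
of schemes. -/
noncomputable def ofSchemeHom {T : Over (Spec (CommRingCat.of k))} {Y : LogScheme k}
    (u : T ⟶ Y.toOver) : ofScheme T ⟶ Y :=
  ({ base := u
     flat V := ((u.left.app V).hom : Γ(Y.toOver.left, V) →* Γ(T.left, u.left ⁻¹ᵁ V)).comp (Y.log.α V)
     flat_res {U V} j s := by
      refine (congrArg (u.left.app U) (Y.log.α_res j s)).trans ?_
      exact app_res u.left j _
     α_flat _ _ := rfl } : Hom (ofScheme T) Y)

/-- On the source `α` is the identity, so compatibility with `α` determines the map of monoids. Log
morphisms out of `ofScheme T` thus carry no data beyond the underlying morphism. -/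
theorem ofSchemeHom_ext {T : Over (Spec (CommRingCat.of k))} {Y : LogScheme k}
    {f g : ofScheme T ⟶ Y} (h : (forget k).map f = (forget k).map g) : f = g := by
  obtain ⟨b, φ, h1, h2⟩ := f
  obtain ⟨b', φ', h1', h2'⟩ := g
  obtain rfl : b = b' := h
  obtain rfl : φ = φ' := by
    funext V
    ext s
    exact (h2 V s).trans (h2' V s).symm
  rfl

theorem ofSchemeHom_comp {S T : Over (Spec (CommRingCat.of k))} {Y : LogScheme k} (u : S ⟶ T)
    (v : T ⟶ Y.toOver) :
    ofSchemeHom (u ≫ v) = ofSchemeHom (Y := ofScheme T) u ≫ ofSchemeHom v :=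
  ofSchemeHom_ext rfl

variable {m : ℕ} {T : Over (Spec (CommRingCat.of k))} {X : LogScheme k}

/-- The jet underlying a log jet. -/
noncomputable def jet (H : (thicken m).obj (ofScheme T) ⟶ X) : (thickening m).obj T ⟶ X.toOver :=
  Hom.base H

/-- The factor `g` in the pullback `φ^♯ α(s) = (φ^♯ α(s))|_{t = 0} * g` under a log jet. -/
noncomputable def twist (H : (thicken m).obj (ofScheme T) ⟶ X) (V : X.toOver.left.Opens) :
    X.log.sec V →* Γ(((thickening m).obj T).left, (jet H).left ⁻¹ᵁ V) :=
  ((oneUnits (thickeningZero m T).left ((jet H).left ⁻¹ᵁ V)).subtype.comp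
    (MonoidHom.snd _ _)).comp (Hom.flat H V)

theorem twist_res (H : (thicken m).obj (ofScheme T) ⟶ X) : IsResCompatible (twist H) := by
  intro U V j s
  exact congrArg (fun x => x.2.1) (Hom.flat_res H j s)

theorem twist_mem_oneUnits (H : (thicken m).obj (ofScheme T) ⟶ X) (V : X.toOver.left.Opens)
    (s : X.log.sec V) : twist H V s ∈ oneUnits (thickeningZero m T).left _ :=
  (Hom.flat H V s).2.2

/-- The map `s ↦ φ^♯ α(s)`. -/
noncomputable def pullbackFun (φ : (thickening m).obj T ⟶ X.toOver) (V : X.toOver.left.Opens) :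
    X.log.sec V →* Γ(((thickening m).obj T).left, φ.left ⁻¹ᵁ V) :=
  ((φ.left.app V).hom : _ →* _).comp (X.log.α V)

theorem pullbackFun_res (φ : (thickening m).obj T ⟶ X.toOver) :
    IsResCompatible (pullbackFun (X := X) φ) := by
  intro U V j s
  refine (congrArg (φ.left.app U) (X.log.α_res j s)).trans ?_
  exact app_res φ.left j _

variable (m T) in
/-- `g ↦ g|_{t = 0}` on functions on `T × Spec k[t]/(t^{m+1})`. -/
noncomputable def constJet (W : ((thickening m).obj T).left.Opens) :
    Γ(((thickening m).obj T).left, W) →+* Γ(((thickening m).obj T).left, W) :=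
  constPart _ _ (thickeningZero_proj m T) (thickeningZero_surjective m T) W

/-- The map `s ↦ (φ^♯ α(s))|_{t = 0}`. -/
noncomputable def pullbackConst (φ : (thickening m).obj T ⟶ X.toOver) (V : X.toOver.left.Opens) :
    X.log.sec V →* Γ(((thickening m).obj T).left, φ.left ⁻¹ᵁ V) :=
  (constJet m T (φ.left ⁻¹ᵁ V) : _ →* _).comp (pullbackFun φ V)

theorem pullbackConst_res (φ : (thickening m).obj T ⟶ X.toOver) :
    IsResCompatible (pullbackConst (X := X) φ) := by
  intro U V j s
  refine (congrArg (constJet m T _) (pullbackFun_res φ j s)).trans ?_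
  exact constPart_res _ _ _ _ _ _

theorem app_pullbackConst (φ : (thickening m).obj T ⟶ X.toOver) (V : X.toOver.left.Opens)
    (s : X.log.sec V) :
    (thickeningZero m T).left.app _ (pullbackConst φ V s) =
      (thickeningZero m T).left.app _ (pullbackFun φ V s) :=
  app_constPart _ _ (thickeningZero_proj m T) (thickeningZero_surjective m T) _ _

/-- The first component of the pullback of `s` under a log jet. -/
noncomputable def flatFst (H : (thicken m).obj (ofScheme T) ⟶ X) (V : X.toOver.left.Opens)
    (s : X.log.sec V) : Γ(T.left, (thickeningZero m T).left ⁻¹ᵁ ((jet H).left ⁻¹ᵁ V)) :=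
  (Hom.flat H V s).1

theorem pullbackFun_eq_appLE_mul_twist (H : (thicken m).obj (ofScheme T) ⟶ X)
    (V : X.toOver.left.Opens) (s : X.log.sec V) :
    pullbackFun (jet H) V s = (thickeningProj m T).left.appLE _ _
      (le_preimage_preimage _ _ (thickeningZero_proj m T) (thickeningZero_surjective m T) _)
      (flatFst H V s) * twist H V s :=
  (Hom.α_flat H V s).symm

/-- Setting `t = 0` in `φ^♯ α(s) = p^♯(first component) * g` kills the factor `g`. The first
component is therefore determined by the jet, and the only extra datum of a log jet is its family of
factors. -/
theorem flatFst_eq (H : (thicken m).obj (ofScheme T) ⟶ X) (V : X.toOver.left.Opens)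
    (s : X.log.sec V) :
    flatFst H V s = (thickeningZero m T).left.app _ (pullbackFun (jet H) V s) := by
  rw [pullbackFun_eq_appLE_mul_twist, map_mul, app_appLE_apply _ _ (thickeningZero_proj m T)]
  refine Eq.trans ?_ (congrArg (flatFst H V s * ·) (twist_mem_oneUnits H V s).symm)
  exact (mul_one _).symm

theorem pullbackFun_eq_mul_twist (H : (thicken m).obj (ofScheme T) ⟶ X) (V : X.toOver.left.Opens)
    (s : X.log.sec V) :
    pullbackFun (jet H) V s = pullbackConst (jet H) V s * twist H V s := by
  refine (pullbackFun_eq_appLE_mul_twist H V s).trans (congrArg (· * _) ?_)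
  rw [flatFst_eq]
  rfl

/-- The log jet with underlying jet `φ` and a given family of factors. -/
noncomputable def mkLogJet (φ : (thickening m).obj T ⟶ X.toOver)
    (g : ∀ V, X.log.sec V →* Γ(((thickening m).obj T).left, φ.left ⁻¹ᵁ V))
    (hg : IsResCompatible g) (hg1 : ∀ V s, g V s ∈ oneUnits (thickeningZero m T).left _)
    (h : ∀ V s, pullbackFun φ V s = pullbackConst φ V s * g V s) :
    (thicken m).obj (ofScheme T) ⟶ X :=
  ({ base := φ
     flat V := MonoidHom.prod
      ((((thickeningZero m T).left.app (φ.left ⁻¹ᵁ V)).hom :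
        Γ(((thickening m).obj T).left, φ.left ⁻¹ᵁ V) →*
          Γ(T.left, (thickeningZero m T).left ⁻¹ᵁ (φ.left ⁻¹ᵁ V))).comp (pullbackFun φ V))
      ((g V).codRestrict (oneUnits (thickeningZero m T).left (φ.left ⁻¹ᵁ V)) (hg1 V))
     flat_res {U V} j s := by
      refine Prod.ext ?_ (Subtype.ext (hg j s))
      refine (congrArg ((thickeningZero m T).left.app (φ.left ⁻¹ᵁ U))
        (pullbackFun_res φ j s)).trans ?_
      exact app_res (thickeningZero m T).left ((Opens.map φ.left.base).map j) _
     α_flat V s := (h V s).symm } : Hom (thickenObj m (ofScheme T)) X)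

/-- The factor of a section on an open subset that contains the image of the log jet. -/
noncomputable def twistTop (H : (thicken m).obj (ofScheme T) ⟶ X) (U : X.toOver.left.Opens)
    (hU : ∀ y, (jet H).left y ∈ U) :
    X.log.sec U →* Γ(((thickening m).obj T).left, ⊤) :=
  ((((thickening m).obj T).left.presheaf.map
    (homOfLE fun y _ => hU y : ⊤ ⟶ (jet H).left ⁻¹ᵁ U).op).hom :
      Γ(((thickening m).obj T).left, (jet H).left ⁻¹ᵁ U) →*
        Γ(((thickening m).obj T).left, ⊤)).comp (twist H U)

theorem twist_eq_res_twistTop (H : (thicken m).obj (ofScheme T) ⟶ X) (U : X.toOver.left.Opens)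
    (hU : ∀ y, (jet H).left y ∈ U) (s : X.log.sec U) :
    twist H U s =
      ((thickening m).obj T).left.presheaf.map (homOfLE le_top).op (twistTop H U hU s) := by
  rw [twistTop]
  exact (Scheme.presheaf_map_map_self _ _ _ _).symm

/-- The first components depend only on the jet (`flatFst_eq`), and the factors are determined by
their values on a chart (`eq_of_eq_on_chart`). -/
theorem logJet_ext {H H' : (thicken m).obj (ofScheme T) ⟶ X}
    (hb : jet H = jet H') {U : X.toOver.left.Opens} {P : Type u} [CommMonoid P]
    {β : P →* X.log.sec U} (hβ : X.log.IsChart U β) (hU : ∀ y, (jet H).left y ∈ U)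
    (hU' : ∀ y, (jet H').left y ∈ U)
    (ht : ∀ p, twistTop H U hU (β p) = twistTop H' U hU' (β p)) : H = H' := by
  have h1 : IsResCompatible (twist H) := twist_res H
  have h2 := pullbackFun_eq_mul_twist H
  have h1' : IsResCompatible (twist H') := twist_res H'
  have h2' := pullbackFun_eq_mul_twist H'
  have h3 := flatFst_eq H
  have h3' := flatFst_eq H'
  have h4 : ∀ p, twist H U (β p) = ((thickening m).obj T).left.presheaf.map (homOfLE le_top).op
    (twistTop H' U hU' (β p)) := fun p => by rw [twist_eq_res_twistTop H U hU, ht]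
  have h4' : ∀ p, twist H' U (β p) = ((thickening m).obj T).left.presheaf.map (homOfLE le_top).op
    (twistTop H' U hU' (β p)) := fun p => by rw [twist_eq_res_twistTop H' U hU']
  generalize twistTop H' U hU' = τ at h4 h4'
  obtain ⟨b, φ, r1, r2⟩ := H
  obtain ⟨b', φ', r1', r2'⟩ := H'
  obtain rfl : b = b' := hb
  obtain rfl : φ = φ' := by
    have h5 := eq_of_eq_on_chart (pullbackConst_res b) h1 h1' h2 h2' hβ hU
      fun p => (h4 p).trans (h4' p).symm
    funext V
    ext s
    refine Prod.ext ((h3 V s).trans (h3' V s).symm) (Subtype.ext ?_)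
    exact congrArg (fun f => f V s) h5
  rfl

/-- This is `exists_extension` for the families `a(s) = φ^♯ α(s)` and `b(s) = (φ^♯ α(s))|_{t=0}`,
which agree at `t = 0`. -/
theorem exists_logJet (φ : (thickening m).obj T ⟶ X.toOver) {U : X.toOver.left.Opens} {P : Type u}
    [CommMonoid P] {β : P →* X.log.sec U} (hβ : X.log.IsChart U β) (hU : ∀ y, φ.left y ∈ U)
    (χ : P →* jetUnits m T)
    (hχ : ∀ p, pullbackFun φ U (β p) = pullbackConst φ U (β p) *
      ((thickening m).obj T).left.presheaf.map (homOfLE le_top).op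
        ((χ p).1 : Γ(((thickening m).obj T).left, ⊤))) :
    ∃ (H : (thicken m).obj (ofScheme T) ⟶ X) (hb : jet H = φ),
      ∀ p, twistTop H U (by rw [hb]; exact hU) (β p) = (χ p).1 := by
  obtain ⟨g, hg, h1, h2, h3⟩ := exists_extension (i := (thickeningZero m T).left)
    (χ := (Units.coeHom _).comp ((jetUnits m T).subtype.comp χ)) (pullbackFun_res φ)
    (pullbackConst_res φ) hβ hU (thickeningZero_surjective m T)
    (fun V s => (app_pullbackConst φ V s).symm) (fun p => mem_jetUnits.1 (χ p).2) hχ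
  refine ⟨mkLogJet φ g hg h2 h1, rfl, fun p => ?_⟩
  refine (congrArg (((thickening m).obj T).left.presheaf.map _) (h3 p)).trans ?_
  exact Scheme.presheaf_map_map_self _ _ _ _

theorem twistTop_comp {S : Over (Spec (CommRingCat.of k))} (u : S ⟶ T)
    (H : (thicken m).obj (ofScheme T) ⟶ X) (U : X.toOver.left.Opens)
    (hU : ∀ y, (jet H).left y ∈ U)
    (hU' : ∀ y, (jet ((thicken m).map (ofSchemeHom (Y := ofScheme T) u) ≫ H)).left y ∈ U)
    (s : X.log.sec U) :
    twistTop ((thicken m).map (ofSchemeHom (Y := ofScheme T) u) ≫ H) U hU' s =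
      ((thickening m).map u).left.appTop (twistTop H U hU s) := by
  have h1 := app_res ((thickening m).map u).left
    (homOfLE fun y _ => hU y : ⊤ ⟶ (jet H).left ⁻¹ᵁ U) (twist H U s)
  exact h1.symm

end LogScheme

/-! ### Morphisms into an immersed subscheme -/

section Factor

variable {X Y Z R : Scheme.{u}}

theorem germ_app_congr {f g : Y ⟶ X} (h : f = g) (U : X.Opens) (a : Γ(X, U)) (y : Y)
    (hf : f y ∈ U) (hg : g y ∈ U) :
    Y.presheaf.germ (f ⁻¹ᵁ U) y hf (f.app U a) = Y.presheaf.germ (g ⁻¹ᵁ U) y hg (g.app U a) := by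
  subst h
  rfl

theorem germ_app_of_res_eq (f : Y ⟶ X) {U V W : X.Opens} (i : W ⟶ U) (j : W ⟶ V) {a : Γ(X, U)}
    {b : Γ(X, V)} (h : X.presheaf.map i.op a = X.presheaf.map j.op b) (y : Y) (hy : f y ∈ W) :
    Y.presheaf.germ (f ⁻¹ᵁ U) y (i.le hy) (f.app U a) =
      Y.presheaf.germ (f ⁻¹ᵁ V) y (j.le hy) (f.app V b) := by
  have h1 := congrArg (Y.presheaf.germ (f ⁻¹ᵁ W) y hy) (app_res f i a)
  have h2 := congrArg (Y.presheaf.germ (f ⁻¹ᵁ W) y hy) (app_res f j b)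
  rw [h] at h1
  have h3 := (h1.symm.trans h2)
  exact (Y.presheaf.germ_res_apply ((Opens.map f.base).map i) y hy (f.app U a)).symm.trans
    (h3.trans (Y.presheaf.germ_res_apply ((Opens.map f.base).map j) y hy (f.app V b)))

/-- Near each point, functions that vanish on `Z` vanish on `Y`. -/
def VanishesWith (f : Y ⟶ X) (ι : Z ⟶ X) : Prop :=
  ∀ y, ∃ z, ι z = f y ∧ ∀ (U : X.Opens) (a : Γ(X, U)) (hz : ι z ∈ U) (hy : f y ∈ U),
    Z.presheaf.germ (ι ⁻¹ᵁ U) z hz (ι.app U a) = 0 → Y.presheaf.germ (f ⁻¹ᵁ U) y hy (f.app U a) = 0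

/-- An open immersion is an isomorphism on stalks, so every germ of a function on `R` comes from
`X`. -/
theorem VanishesWith.of_comp {f : Y ⟶ R} {c : Z ⟶ R} (j : R ⟶ X) [IsOpenImmersion j]
    (h : VanishesWith (f ≫ j) (c ≫ j)) : VanishesWith f c := by
  intro y
  obtain ⟨z, hz, h⟩ := h y
  have hzy : c z = f y := j.isOpenEmbedding.injective hz
  refine ⟨z, hzy, fun U a hzU hyU ha => ?_⟩
  have h1 : Function.Surjective (j.stalkMap (f y)) :=
    (ConcreteCategory.bijective_of_isIso (j.stalkMap (f y))).2
  obtain ⟨t, ht⟩ := h1 (R.presheaf.germ U (f y) hyU a)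
  obtain ⟨V, hV, b, rfl⟩ := X.presheaf.exists_germ_eq t
  have h2 : R.presheaf.germ (j ⁻¹ᵁ V) (f y) hV (j.app V b) = R.presheaf.germ U (f y) hyU a :=
    (Scheme.Hom.germ_stalkMap_apply j V (f y) hV b).symm.trans ht
  obtain ⟨W, hW, i₁, i₂, hi⟩ := R.presheaf.germ_eq (f y) _ _ _ _ h2
  have h3 := germ_app_of_res_eq c i₁ i₂ hi z (hzy ▸ hW)
  have h4 := germ_app_of_res_eq f i₁ i₂ hi y hW
  have h5 := h V b (by rw [hz]; exact hV) hV (h3.trans ha)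
  exact h4.symm.trans h5

/-- An immersion is a closed immersion into an open subscheme. The image of `f` lies in this open
set, and functions in the ideal of `Z` there pull back to zero on `Y`, as can be checked on germs.
-/
theorem VanishesWith.exists_lift {f : Y ⟶ X} {ι : Z ⟶ X} [IsImmersion ι] (h : VanishesWith f ι) :
    ∃ f' : Y ⟶ Z, f' ≫ ι = f := by
  have hr : Set.range f ⊆ Set.range ι.coborderRange.ι := by
    rintro _ ⟨y, rfl⟩
    obtain ⟨z, hz, -⟩ := h y
    refine ⟨ι.liftCoborder z, ?_⟩
    rw [← Scheme.Hom.comp_apply, ι.liftCoborder_ι, hz]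
  have h0 := IsOpenImmersion.lift_fac ι.coborderRange.ι f hr
  set f₀ := IsOpenImmersion.lift ι.coborderRange.ι f hr
  have h1 : VanishesWith (f₀ ≫ ι.coborderRange.ι) (ι.liftCoborder ≫ ι.coborderRange.ι) := by
    rw [h0, ι.liftCoborder_ι]
    exact h
  have h2 := h1.of_comp
  have h3 : ι.liftCoborder.ker ≤ f₀.ker := by
    refine Scheme.IdealSheafData.le_ofIdeals_iff.2 fun U a ha => ?_
    have ha' : ι.liftCoborder.app U a = 0 := ι.liftCoborder.ideal_ker_le U ha
    change f₀.app U a = 0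
    refine section_ext_germ fun y hy => ?_
    obtain ⟨z, hz, h4⟩ := h2 y
    have h5 := h4 U a (by rw [hz]; exact hy) hy (by rw [ha', map_zero])
    rw [map_zero]
    exact h5
  refine ⟨IsClosedImmersion.lift ι.liftCoborder f₀ h3, ?_⟩
  calc _ = IsClosedImmersion.lift ι.liftCoborder f₀ h3 ≫ ι.liftCoborder ≫ ι.coborderRange.ι := by
        rw [ι.liftCoborder_ι]
    _ = f := by rw [← Category.assoc, IsClosedImmersion.lift_fac, h0]

end Factor

/-! ### Log jets in a stratum -/

namespace LogScheme

variable {k : Type u} [Field k] {m : ℕ} {T : Over (Spec (CommRingCat.of k))} {X : LogScheme k}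

theorem mem_nonunitIdeal_of_germ_eq_zero {j : ℕ} {X Z : Scheme.{u}} {L : LogStructure X}
    {ι : Z ⟶ X} (hι : L.IsStratum j ι) {U : X.Opens} {a : Γ(X, U)} (z : Z) (hz : ι z ∈ U) :
    Z.presheaf.germ (ι ⁻¹ᵁ U) z hz (ι.app U a) = 0 ↔
      X.presheaf.germ U (ι z) hz a ∈ L.nonunitIdeal (ι z) := by
  rw [← hι.ker_stalkMap, RingHom.mem_ker]
  exact Eq.congr_left (Scheme.Hom.germ_stalkMap_apply ι U z hz a).symm

theorem germ_pullbackConst (φ : (thickening m).obj T ⟶ X.toOver) (e : T.left)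
    (V : X.toOver.left.Opens) (s : X.log.sec V)
    (hV : φ.left ((thickeningZero m T).left e) ∈ V)
    (h : T.left.presheaf.germ ((thickeningZero m T).left ⁻¹ᵁ (φ.left ⁻¹ᵁ V)) e hV
      ((thickeningZero m T).left.app _ (pullbackFun φ V s)) = 0) :
    ((thickening m).obj T).left.presheaf.germ (φ.left ⁻¹ᵁ V) ((thickeningZero m T).left e) hV
      (pullbackConst φ V s) = 0 := by
  have h1 : (thickeningProj m T).left ((thickeningZero m T).left e) = e := by
    rw [← Scheme.Hom.comp_apply, thickeningZero_proj]
    rfl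
  have h2 : ∀ (e' : T.left) (he : e' = e) (he' : e' ∈ (thickeningZero m T).left ⁻¹ᵁ (φ.left ⁻¹ᵁ V)),
      T.left.presheaf.germ ((thickeningZero m T).left ⁻¹ᵁ (φ.left ⁻¹ᵁ V)) e' he'
      ((thickeningZero m T).left.app _ (pullbackFun φ V s)) = 0 := by
    rintro _ rfl _
    exact h
  have h3 : (thickeningProj m T).left ((thickeningZero m T).left e) ∈
      (thickeningZero m T).left ⁻¹ᵁ (φ.left ⁻¹ᵁ V) := by
    rw [h1]
    exact hV
  have h4 := congrArg ((thickeningProj m T).left.stalkMap ((thickeningZero m T).left e))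
    (h2 _ h1 h3)
  rw [map_zero] at h4
  refine Eq.trans ?_ h4
  refine Eq.trans ?_ (Scheme.Hom.germ_stalkMap_apply (thickeningProj m T).left _ _ h3 _).symm
  exact ((thickening m).obj T).left.presheaf.germ_res_apply _ _ _ _

/-- The ideal of `Z` is generated by the `α(s)` with `s` a nonunit. These vanish at `t = 0` because
the jet starts in `Z`, and the factorization `φ^♯ α(s) = (φ^♯ α(s))|_{t=0} * g` then makes them
vanish along the whole jet. -/
theorem vanishesWith_jet {j : ℕ} {Z : Over (Spec (CommRingCat.of k))} {ι : Z ⟶ X.toOver}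
    (hι : X.log.IsStratum j ι.left) (H : (thicken m).obj (ofScheme T) ⟶ X) (ζ : T ⟶ Z)
    (hζ : thickeningZero m T ≫ jet H = ζ ≫ ι) : VanishesWith (jet H).left ι.left := by
  have hζ' : (thickeningZero m T).left ≫ (jet H).left = ζ.left ≫ ι.left :=
    congrArg (fun f => f.left) hζ
  intro y
  obtain ⟨e, rfl⟩ := thickeningZero_surjective m T y
  have he : ι.left (ζ.left e) = (jet H).left ((thickeningZero m T).left e) := by
    rw [← Scheme.Hom.comp_apply, ← Scheme.Hom.comp_apply, hζ']
  refine ⟨ζ.left e, he, fun U a hz hy ha => ?_⟩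
  rw [mem_nonunitIdeal_of_germ_eq_zero hι] at ha
  have key : ∀ x (hx : x = ι.left (ζ.left e)) (hxU : x ∈ U)
      (hx' : x = (jet H).left ((thickeningZero m T).left e)),
      X.toOver.left.presheaf.germ U x hxU a ∈ X.log.nonunitIdeal x := by
    rintro x rfl _ _
    exact ha
  have h1 := key _ he.symm hy rfl
  have h2 : X.log.nonunitIdeal ((jet H).left ((thickeningZero m T).left e)) ≤
      RingHom.ker ((jet H).left.stalkMap ((thickeningZero m T).left e)).hom := by
    refine Ideal.span_le.2 ?_
    rintro _ ⟨V, hV, s, hs, rfl⟩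
    refine (Scheme.Hom.germ_stalkMap_apply (jet H).left V _ hV _).trans ?_
    have h3 : ((thickening m).obj T).left.presheaf.germ ((jet H).left ⁻¹ᵁ V)
        ((thickeningZero m T).left e) hV (pullbackConst (jet H) V s) = 0 := by
      refine germ_pullbackConst _ e V s hV ?_
      have hV' : ι.left (ζ.left e) ∈ V := by rw [he]; exact hV
      refine (germ_app_congr hζ' V (X.log.α V s) e hV hV').trans ?_
      refine (Scheme.Hom.germ_stalkMap_apply ζ.left (ι.left ⁻¹ᵁ V) e hV' _).symm.trans ?_
      have hs' : ∀ x (hx : x = (jet H).left ((thickeningZero m T).left e)) (hxV : x ∈ V),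
          ¬ IsUnit (X.log.germ V x hxV s) := by
        rintro x rfl _
        exact hs
      have h5 : Z.left.presheaf.germ (ι.left ⁻¹ᵁ V) (ζ.left e) hV'
          (ι.left.app V (X.log.α V s)) = 0 :=
        (mem_nonunitIdeal_of_germ_eq_zero hι (ζ.left e) hV').2
          (Ideal.subset_span ⟨V, hV', s, hs' _ he hV', rfl⟩)
      exact (congrArg (ζ.left.stalkMap e) h5).trans (map_zero _)
    have h4 := congrArg (((thickening m).obj T).left.presheaf.germ ((jet H).left ⁻¹ᵁ V)
        ((thickeningZero m T).left e) hV) (pullbackFun_eq_mul_twist H V s)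
    rw [map_mul, h3, zero_mul] at h4
    exact h4
  exact (Scheme.Hom.germ_stalkMap_apply (jet H).left U _ hy a).symm.trans (h2 h1)

theorem exists_jet_in_stratum {j : ℕ} {Z : Over (Spec (CommRingCat.of k))} {ι : Z ⟶ X.toOver}
    (hι : X.log.IsStratum j ι.left) (H : (thicken m).obj (ofScheme T) ⟶ X) (ζ : T ⟶ Z)
    (hζ : thickeningZero m T ≫ jet H = ζ ≫ ι) :
    ∃ ψ : (thickening m).obj T ⟶ Z, ψ ≫ ι = jet H := by
  have := hι.isImmersion
  obtain ⟨f, hf⟩ := (vanishesWith_jet hι H ζ hζ).exists_lift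
  refine ⟨Over.homMk f ?_, Over.OverMorphism.ext hf⟩
  rw [← Over.w ι, ← Category.assoc, hf, Over.w]

end LogScheme

theorem Algebra.GrothendieckGroup.eq_of_eq_of {M G : Type*} [CommMonoid M] [CommGroup G]
    {f g : GrothendieckGroup M →* G}
    (h : ∀ a, f (GrothendieckGroup.of a) = g (GrothendieckGroup.of a)) : f = g := by
  refine MonoidHom.ext fun z => ?_
  obtain ⟨a, b, rfl⟩ := exists_eq_div z
  rw [map_div, map_div, h, h]

/-! ### Log jets with a given underlying jet in a stratum -/

namespace LogScheme

variable {k : Type u} [Field k] {m : ℕ} {T : Over (Spec (CommRingCat.of k))} {X : LogScheme k}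

/-- The function `φ^♯ α(s)` for a section `s` on an open subset that contains the image of `φ`. -/
noncomputable def pullbackTop (φ : (thickening m).obj T ⟶ X.toOver) (U : X.toOver.left.Opens)
    (hU : ∀ y, φ.left y ∈ U) : X.log.sec U →* Γ(((thickening m).obj T).left, ⊤) :=
  ((((thickening m).obj T).left.presheaf.map
    (homOfLE fun y _ => hU y : ⊤ ⟶ φ.left ⁻¹ᵁ U).op).hom :
      Γ(((thickening m).obj T).left, φ.left ⁻¹ᵁ U) →*
        Γ(((thickening m).obj T).left, ⊤)).comp (pullbackFun φ U)

theorem pullbackTop_congr {φ φ' : (thickening m).obj T ⟶ X.toOver} (h : φ = φ')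
    (U : X.toOver.left.Opens) (hU : ∀ y, φ.left y ∈ U) (hU' : ∀ y, φ'.left y ∈ U) :
    pullbackTop φ U hU = pullbackTop φ' U hU' := by
  subst h
  rfl

theorem res_pullbackTop (φ : (thickening m).obj T ⟶ X.toOver) (U : X.toOver.left.Opens)
    (hU : ∀ y, φ.left y ∈ U) (s : X.log.sec U) :
    ((thickening m).obj T).left.presheaf.map (homOfLE le_top).op (pullbackTop φ U hU s) =
      pullbackFun φ U s :=
  Scheme.presheaf_map_map_self _ _ _ _

theorem res_constJet_pullbackTop (φ : (thickening m).obj T ⟶ X.toOver) (U : X.toOver.left.Opens)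
    (hU : ∀ y, φ.left y ∈ U) (s : X.log.sec U) :
    ((thickening m).obj T).left.presheaf.map (homOfLE le_top).op
      (constJet m T ⊤ (pullbackTop φ U hU s)) = pullbackConst φ U s := by
  refine (constPart_res _ _ (thickeningZero_proj m T) (thickeningZero_surjective m T)
    _ _).symm.trans ?_
  exact congrArg (constJet m T _) (res_pullbackTop φ U hU s)

theorem pullbackTop_eq_mul_twistTop (H : (thicken m).obj (ofScheme T) ⟶ X)
    (U : X.toOver.left.Opens) (hU : ∀ y, (jet H).left y ∈ U) (s : X.log.sec U) :
    pullbackTop (jet H) U hU s =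
      constJet m T ⊤ (pullbackTop (jet H) U hU s) * twistTop H U hU s := by
  refine (congrArg (((thickening m).obj T).left.presheaf.map
    (homOfLE fun y _ => hU y : ⊤ ⟶ (jet H).left ⁻¹ᵁ U).op) (pullbackFun_eq_mul_twist H U s)).trans ?_
  rw [map_mul]
  refine congrArg (· * twistTop H U hU s) ?_
  exact (constPart_res _ _ (thickeningZero_proj m T) (thickeningZero_surjective m T) _ _).symm

theorem app_twistTop (H : (thicken m).obj (ofScheme T) ⟶ X)
    (U : X.toOver.left.Opens) (hU : ∀ y, (jet H).left y ∈ U) (s : X.log.sec U) :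
    (thickeningZero m T).left.appTop (twistTop H U hU s) = 1 := by
  refine (app_res (thickeningZero m T).left
    (homOfLE fun y _ => hU y : ⊤ ⟶ (jet H).left ⁻¹ᵁ U) (twist H U s)).trans ?_
  refine (congrArg _ (twist_mem_oneUnits H U s)).trans ?_
  exact map_one _

/-- The factor of a section, as a unit. -/
noncomputable def twistUnits (H : (thicken m).obj (ofScheme T) ⟶ X)
    (U : X.toOver.left.Opens) (hU : ∀ y, (jet H).left y ∈ U) : X.log.sec U →* jetUnits m T :=
  (Units.liftRight (twistTop H U hU) (fun s => (isUnit_of_mem_oneUnits (thickeningZero m T).left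
    (thickeningZero_surjective m T) (W := ⊤) (g := twistTop H U hU s)
      (app_twistTop H U hU s)).unit) fun _ => rfl).codRestrict _
    fun s => mem_jetUnits.2 (app_twistTop H U hU s)

theorem twistUnits_val (H : (thicken m).obj (ofScheme T) ⟶ X)
    (U : X.toOver.left.Opens) (hU : ∀ y, (jet H).left y ∈ U) (s : X.log.sec U) :
    ((twistUnits H U hU s).1 : Γ(((thickening m).obj T).left, ⊤)) = twistTop H U hU s := rfl

theorem twistUnits_comp {S : Over (Spec (CommRingCat.of k))} (u : S ⟶ T)
    (H : (thicken m).obj (ofScheme T) ⟶ X) (U : X.toOver.left.Opens)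
    (hU : ∀ y, (jet H).left y ∈ U)
    (hU' : ∀ y, (jet ((thicken m).map (ofSchemeHom (Y := ofScheme T) u) ≫ H)).left y ∈ U)
    (s : X.log.sec U) :
    twistUnits ((thicken m).map (ofSchemeHom (Y := ofScheme T) u) ≫ H) U hU' s =
      jetUnitsMap u (twistUnits H U hU s) :=
  Subtype.ext (Units.ext (twistTop_comp u H U hU hU' s))

/-- Where `φ^♯ α(s)` is invertible, the factor is its quotient by its value at `t = 0`, so it
depends only on the jet. -/
theorem twistUnits_eq_of_isUnit {H H' : (thicken m).obj (ofScheme T) ⟶ X} (hb : jet H = jet H')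
    (U : X.toOver.left.Opens) (hU : ∀ y, (jet H).left y ∈ U) (hU' : ∀ y, (jet H').left y ∈ U)
    {s : X.log.sec U} (hs : IsUnit (X.log.α U s)) : twistUnits H U hU s = twistUnits H' U hU' s := by
  refine Subtype.ext (Units.ext ?_)
  have h1 := pullbackTop_eq_mul_twistTop H U hU s
  have h2 := pullbackTop_eq_mul_twistTop H' U hU' s
  rw [← pullbackTop_congr hb U hU hU'] at h2
  have h3 : IsUnit (pullbackTop (jet H) U hU s) := (hs.map ((jet H).left.app U).hom).map
    (((thickening m).obj T).left.presheaf.map (homOfLE fun y _ => hU y : ⊤ ⟶ (jet H).left ⁻¹ᵁ U).op).hom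
  exact (h3.map (constJet m T ⊤)).mul_left_cancel (h1.symm.trans h2)

/-- Chart elements outside the face are nonunits along the stratum, so their images under `α` lie in
its ideal. For a jet in the stratum they impose no condition on the factors. -/
theorem pullbackTop_eq_zero {j : ℕ} {Z : Over (Spec (CommRingCat.of k))} {ι : Z ⟶ X.toOver}
    (hι : X.log.IsStratum j ι.left) (C : X.log.StratumChart j) (ψ : (thickening m).obj T ⟶ Z)
    (hU : ∀ y, (ψ ≫ ι).left y ∈ C.U) {p : C.P} (hp : p ∉ C.F) :
    pullbackTop (ψ ≫ ι) C.U hU (C.β p) = 0 := by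
  have h1 : ι.left.app C.U (X.log.α C.U (C.β p)) = 0 := by
    refine section_ext_germ fun z hz => ?_
    rw [map_zero]
    have hr : X.log.rank (ι.left z) = j := (hι.range_eq ▸ Set.mem_range_self z :)
    exact (mem_nonunitIdeal_of_germ_eq_zero hι z hz).2
      (Ideal.subset_span ⟨C.U, hz, C.β p, C.not_isUnit _ hz p hr hp, rfl⟩)
  have h2 : pullbackFun (ψ ≫ ι) C.U (C.β p) = 0 := by
    refine Eq.trans ?_ (map_zero (ψ.left.app (ι.left ⁻¹ᵁ C.U)).hom)
    rw [← h1]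
    rfl
  refine (congrArg (((thickening m).obj T).left.presheaf.map
    (homOfLE fun y _ => hU y : ⊤ ⟶ (ψ ≫ ι).left ⁻¹ᵁ C.U).op) h2).trans ?_
  exact map_zero (((thickening m).obj T).left.presheaf.map
    (homOfLE fun y _ => hU y : ⊤ ⟶ (ψ ≫ ι).left ⁻¹ᵁ C.U).op).hom

/-- The homomorphism on the group of a chart given by the factors of a log jet. -/
noncomputable def chartUnits {j : ℕ} (C : X.log.StratumChart j)
    (H : (thicken m).obj (ofScheme T) ⟶ X) (hU : ∀ y, (jet H).left y ∈ C.U) :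
    Algebra.GrothendieckGroup C.P →* jetUnits m T :=
  Algebra.GrothendieckGroup.lift ((twistUnits H C.U hU).comp C.β)

theorem chartUnits_of {j : ℕ} (C : X.log.StratumChart j)
    (H : (thicken m).obj (ofScheme T) ⟶ X) (hU : ∀ y, (jet H).left y ∈ C.U) (p : C.P) :
    chartUnits C H hU (Algebra.GrothendieckGroup.of p) = twistUnits H C.U hU (C.β p) := by
  rw [chartUnits, Algebra.GrothendieckGroup.lift_of]
  rfl

theorem chartUnits_comp {j : ℕ} (C : X.log.StratumChart j) {S : Over (Spec (CommRingCat.of k))}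
    (u : S ⟶ T) (H : (thicken m).obj (ofScheme T) ⟶ X) (hU : ∀ y, (jet H).left y ∈ C.U)
    (hU' : ∀ y, (jet ((thicken m).map (ofSchemeHom (Y := ofScheme T) u) ≫ H)).left y ∈ C.U)
    (z : Algebra.GrothendieckGroup C.P) :
    chartUnits C ((thicken m).map (ofSchemeHom (Y := ofScheme T) u) ≫ H) hU' z =
      jetUnitsMap u (chartUnits C H hU z) := by
  have h : chartUnits C ((thicken m).map (ofSchemeHom (Y := ofScheme T) u) ≫ H) hU' =
      (jetUnitsMap u).comp (chartUnits C H hU) := by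
    refine Algebra.GrothendieckGroup.eq_of_eq_of fun p => ?_
    rw [MonoidHom.comp_apply, chartUnits_of, chartUnits_of]
    exact twistUnits_comp u H C.U hU hU' _
  exact DFunLike.congr_fun h z

/-- The factors of elements of `F` are forced by the jet, and a homomorphism on `P^gp` is determined
by its values on `F` and on the `e i`. -/
theorem eq_of_chartUnits_eq {j : ℕ} (C : X.log.StratumChart j)
    {H H' : (thicken m).obj (ofScheme T) ⟶ X} (hb : jet H = jet H')
    (hU : ∀ y, (jet H).left y ∈ C.U) (hU' : ∀ y, (jet H').left y ∈ C.U)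
    (h : ∀ i, chartUnits C H hU (C.e i) = chartUnits C H' hU' (C.e i)) : H = H' := by
  have h1 := (C.existsUnique (jetUnits m T) (((twistUnits H C.U hU).comp C.β).comp C.F.subtype)
    fun i => chartUnits C H hU (C.e i)).unique (y₁ := chartUnits C H hU) (y₂ := chartUnits C H' hU')
    ⟨fun q => chartUnits_of C H hU q, fun _ => rfl⟩
    ⟨fun q => (chartUnits_of C H' hU' q).trans
      (twistUnits_eq_of_isUnit hb C.U hU hU' (C.isUnit q q.2)).symm, fun i => (h i).symm⟩
  refine logJet_ext hb C.isChart hU hU' fun p => ?_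
  rw [← twistUnits_val, ← twistUnits_val, ← chartUnits_of, ← chartUnits_of, h1]

/-- On `F` the factor has to be `φ^♯ α(q)` divided by its value at `t = 0`. This homomorphism
extends to `P^gp` with arbitrary values `c i` at the `e i`, and any such extension comes from a log
jet. -/
theorem exists_chartUnits_eq {j : ℕ} {Z : Over (Spec (CommRingCat.of k))} {ι : Z ⟶ X.toOver}
    (hι : X.log.IsStratum j ι.left) (C : X.log.StratumChart j) (ψ : (thickening m).obj T ⟶ Z)
    (hU : ∀ y, (ψ ≫ ι).left y ∈ C.U) (c : Fin j → jetUnits m T) :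
    ∃ (H : (thicken m).obj (ofScheme T) ⟶ X) (hb : jet H = ψ ≫ ι),
      ∀ i, chartUnits C H (by rw [hb]; exact hU) (C.e i) = c i := by
  have hu : ∀ q : C.F, IsUnit (pullbackTop (ψ ≫ ι) C.U hU (C.β q)) := fun q =>
    ((C.isUnit q q.2).map ((ψ ≫ ι).left.app C.U).hom).map (((thickening m).obj T).left.presheaf.map
      (homOfLE fun y _ => hU y : ⊤ ⟶ (ψ ≫ ι).left ⁻¹ᵁ C.U).op).hom
  let v : C.F →* Γ(((thickening m).obj T).left, ⊤)ˣ := Units.liftRight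
    (((pullbackTop (ψ ≫ ι) C.U hU).comp C.β).comp C.F.subtype) (fun q => (hu q).unit) fun _ => rfl
  let w : C.F →* Γ(((thickening m).obj T).left, ⊤)ˣ :=
    (Units.map (constJet m T ⊤ : _ →* _)).comp v
  have hvw : ∀ q, (v / w) q ∈ jetUnits m T := by
    intro q
    rw [MonoidHom.mem_ker, MonoidHom.div_apply, map_div, div_eq_one]
    exact Units.ext (app_constPart _ _ (thickeningZero_proj m T) (thickeningZero_surjective m T)
      _ _).symm
  obtain ⟨χ, ⟨h1, h2⟩, -⟩ := C.existsUnique (jetUnits m T) ((v / w).codRestrict _ hvw) c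
  obtain ⟨H, hb, hH⟩ := exists_logJet (ψ ≫ ι) C.isChart hU
    (χ.comp Algebra.GrothendieckGroup.of) fun p => by
      rw [← res_pullbackTop (ψ ≫ ι) C.U hU, ← res_constJet_pullbackTop (ψ ≫ ι) C.U hU, ← map_mul]
      refine congrArg _ ?_
      -- On `F` the equation holds by the choice of `χ`; outside `F` both sides are zero, whatever
      -- `χ` is.
      by_cases hp : p ∈ C.F
      · have h3 := h1 ⟨p, hp⟩
        have h4 : v ⟨p, hp⟩ = w ⟨p, hp⟩ * (χ (Algebra.GrothendieckGroup.of p)).1 := by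
          rw [h3]
          exact (mul_div_cancel _ _).symm
        exact congrArg Units.val h4
      · rw [pullbackTop_eq_zero hι C ψ hU hp, map_zero, zero_mul]
  refine ⟨H, hb, fun i => ?_⟩
  have h5 : chartUnits C H (by rw [hb]; exact hU) = χ := by
    refine Algebra.GrothendieckGroup.eq_of_eq_of fun p => ?_
    rw [chartUnits_of]
    exact Subtype.ext (Units.ext (hH p))
  rw [h5, h2]

/-- The coordinates of a log jet with respect to a chart. -/
noncomputable def chartCoord {j : ℕ} (C : X.log.StratumChart j)
    (H : (thicken m).obj (ofScheme T) ⟶ X) (hU : ∀ y, (jet H).left y ∈ C.U) (i : Fin m × Fin j) :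
    Γ(T.left, ⊤) :=
  (Equiv.ofBijective _ (jetUnitOf_bijective m T)).symm (chartUnits C H hU (C.e i.2)) i.1

theorem jetUnitOf_chartCoord {j : ℕ} (C : X.log.StratumChart j)
    (H : (thicken m).obj (ofScheme T) ⟶ X) (hU : ∀ y, (jet H).left y ∈ C.U) (l : Fin j) :
    jetUnitOf m T (fun i => chartCoord C H hU (i, l)) = chartUnits C H hU (C.e l) := by
  change jetUnitOf m T (fun i => (Equiv.ofBijective _ (jetUnitOf_bijective m T)).symm
    (chartUnits C H hU (C.e l)) i) = _
  generalize chartUnits C H hU (C.e l) = g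
  exact (Equiv.ofBijective _ (jetUnitOf_bijective m T)).apply_symm_apply g

theorem chartCoord_comp {j : ℕ} (C : X.log.StratumChart j) {S : Over (Spec (CommRingCat.of k))}
    (u : S ⟶ T) (H : (thicken m).obj (ofScheme T) ⟶ X) (hU : ∀ y, (jet H).left y ∈ C.U)
    (hU' : ∀ y, (jet ((thicken m).map (ofSchemeHom (Y := ofScheme T) u) ≫ H)).left y ∈ C.U)
    (i : Fin m × Fin j) :
    chartCoord C ((thicken m).map (ofSchemeHom (Y := ofScheme T) u) ≫ H) hU' i =
      u.left.appTop (chartCoord C H hU i) := by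
  have h : (fun a => chartCoord C ((thicken m).map (ofSchemeHom (Y := ofScheme T) u) ≫ H) hU'
      (a, i.2)) = fun a => u.left.appTop (chartCoord C H hU (a, i.2)) := by
    apply (jetUnitOf_bijective m S).1
    rw [jetUnitOf_chartCoord, chartUnits_comp C u H hU hU', ← jetUnitOf_chartCoord,
      jetUnitsMap_jetUnitOf]
  exact congrFun h i.1

theorem eq_of_chartCoord_eq {j : ℕ} (C : X.log.StratumChart j)
    {H H' : (thicken m).obj (ofScheme T) ⟶ X} (hb : jet H = jet H')
    (hU : ∀ y, (jet H).left y ∈ C.U) (hU' : ∀ y, (jet H').left y ∈ C.U)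
    (h : ∀ i, chartCoord C H hU i = chartCoord C H' hU' i) : H = H' := by
  refine eq_of_chartUnits_eq C hb hU hU' fun l => ?_
  rw [← jetUnitOf_chartCoord, ← jetUnitOf_chartCoord]
  exact congrArg _ (funext fun i => h (i, l))

theorem exists_chartCoord_eq {j : ℕ} {Z : Over (Spec (CommRingCat.of k))} {ι : Z ⟶ X.toOver}
    (hι : X.log.IsStratum j ι.left) (C : X.log.StratumChart j) (ψ : (thickening m).obj T ⟶ Z)
    (hU : ∀ y, (ψ ≫ ι).left y ∈ C.U) (a : Fin m × Fin j → Γ(T.left, ⊤)) :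
    ∃ (H : (thicken m).obj (ofScheme T) ⟶ X) (hb : jet H = ψ ≫ ι),
      ∀ i, chartCoord C H (by rw [hb]; exact hU) i = a i := by
  obtain ⟨H, hb, h⟩ := exists_chartUnits_eq hι C ψ hU
    fun l => jetUnitOf m T fun i => a (i, l)
  refine ⟨H, hb, fun i => ?_⟩
  have h1 := h i.2
  rw [← jetUnitOf_chartCoord] at h1
  exact congrFun ((jetUnitOf_bijective m T).1 h1) i.1

end LogScheme

/-! ### A criterion for local triviality -/

/-- `π` is a trivial bundle over `W` if the points of `E` over `W` correspond to points of `W`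
together with coordinates. -/
theorem exists_iso_affineSpace {S : Scheme.{u}} {E B : Over S} (π : E ⟶ B) (W : B.left.Opens)
    {n : Type u}
    (co : ∀ {T : Over S} (l : T ⟶ E), (∀ t, (l ≫ π).left t ∈ W) → n → Γ(T.left, ⊤))
    (co_comp : ∀ {R T : Over S} (u : R ⟶ T) (l : T ⟶ E) (hl : ∀ t, (l ≫ π).left t ∈ W)
      (hl' : ∀ t, ((u ≫ l) ≫ π).left t ∈ W) (i : n), co (u ≫ l) hl' i = u.left.appTop (co l hl i))
    (exists_lift : ∀ {T : Over S} (h : T ⟶ B) (hW : ∀ t, h.left t ∈ W) (a : n → Γ(T.left, ⊤)),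
      ∃ (l : T ⟶ E) (hl : l ≫ π = h), ∀ i, co l (by rw [hl]; exact hW) i = a i)
    (lift_ext : ∀ {T : Over S} (l l' : T ⟶ E) (hl : ∀ t, (l ≫ π).left t ∈ W)
      (hl' : ∀ t, (l' ≫ π).left t ∈ W), l ≫ π = l' ≫ π → (∀ i, co l hl i = co l' hl' i) → l = l') :
    ∃ e : (π.left ⁻¹ᵁ W).toScheme ≅ 𝔸(n; W.toScheme),
      e.hom ≫ (𝔸(n; W.toScheme) ↘ W.toScheme) = π.left ∣_ W := by
  let EW : Over S := Over.mk ((π.left ⁻¹ᵁ W).ι ≫ E.hom)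
  let incl : EW ⟶ E := Over.homMk (π.left ⁻¹ᵁ W).ι rfl
  have hincl : ∀ t, (incl ≫ π).left t ∈ W := fun t => t.2
  -- The isomorphism is given by the coordinates of the tautological point of `π⁻¹ W`.
  let f : (π.left ⁻¹ᵁ W).toScheme ⟶ 𝔸(n; W.toScheme) :=
    AffineSpace.homOfVector (π.left ∣_ W) (co incl hincl)
  let A : Over S := Over.mk ((𝔸(n; W.toScheme) ↘ W.toScheme) ≫ W.ι ≫ B.hom)
  let h : A ⟶ B := Over.homMk ((𝔸(n; W.toScheme) ↘ W.toScheme) ≫ W.ι) (Category.assoc _ _ _)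
  have hW : ∀ t, h.left t ∈ W := fun t => ((𝔸(n; W.toScheme) ↘ W.toScheme) t).2
  -- The inverse is the point of `E` over the affine space whose coordinates are the tautological
  -- ones.
  obtain ⟨l, hl, hco⟩ := exists_lift h hW (AffineSpace.coord W.toScheme)
  have hl0 : ∀ t, (l ≫ π).left t ∈ W := by rw [hl]; exact hW
  have hr : Set.range l.left ⊆ Set.range (π.left ⁻¹ᵁ W).ι := by
    rintro _ ⟨t, rfl⟩
    rw [Scheme.Opens.range_ι]
    exact hl0 t
  let g : 𝔸(n; W.toScheme) ⟶ (π.left ⁻¹ᵁ W).toScheme :=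
    IsOpenImmersion.lift (π.left ⁻¹ᵁ W).ι l.left hr
  have hg : g ≫ (π.left ⁻¹ᵁ W).ι = l.left := IsOpenImmersion.lift_fac _ _ hr
  have hf : f ≫ (𝔸(n; W.toScheme) ↘ W.toScheme) = π.left ∣_ W := AffineSpace.homOfVector_over _ _
  let fO : EW ⟶ A := Over.homMk f (by
    change f ≫ (𝔸(n; W.toScheme) ↘ W.toScheme) ≫ W.ι ≫ B.hom = (π.left ⁻¹ᵁ W).ι ≫ E.hom
    rw [← Category.assoc, hf, ← Category.assoc, morphismRestrict_ι, Category.assoc, Over.w])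
  let gO : A ⟶ EW := Over.homMk g (by
    change g ≫ (π.left ⁻¹ᵁ W).ι ≫ E.hom = A.hom
    rw [← Category.assoc, hg, Over.w])
  have hgO : gO ≫ incl = l := Over.OverMorphism.ext hg
  have hfl : (fO ≫ l) ≫ π = incl ≫ π := by
    rw [Category.assoc, hl]
    apply Over.OverMorphism.ext
    change f ≫ (𝔸(n; W.toScheme) ↘ W.toScheme) ≫ W.ι = (π.left ⁻¹ᵁ W).ι ≫ π.left
    rw [← Category.assoc, hf, morphismRestrict_ι]
  have hfl0 : ∀ t, ((fO ≫ l) ≫ π).left t ∈ W := by rw [hfl]; exact hincl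
  -- Both points of `E` have the same image in `B` and the same coordinates, so `lift_ext` applies.
  have h1 : fO ≫ l = incl := by
    refine lift_ext _ _ hfl0 hincl hfl fun i => ?_
    rw [co_comp fO l hl0, hco]
    exact AffineSpace.homOfVector_appTop_coord _ _ i
  refine ⟨⟨f, g, ?_, ?_⟩, hf⟩
  · rw [← cancel_mono (π.left ⁻¹ᵁ W).ι, Category.assoc, hg, Category.id_comp]
    exact congrArg (fun f => f.left) h1
  · apply AffineSpace.hom_ext
    · rw [Category.assoc, hf, Category.id_comp, ← cancel_mono W.ι, Category.assoc,
        morphismRestrict_ι, ← Category.assoc, hg]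
      exact congrArg (fun f => f.left) hl
    · intro i
      rw [Scheme.Hom.comp_appTop, Scheme.Hom.id_appTop]
      refine (congrArg g.appTop (AffineSpace.homOfVector_appTop_coord _ _ i)).trans ?_
      have h2 : ∀ (l' : A ⟶ E) (h' : l' = l) (hl' : ∀ t, (l' ≫ π).left t ∈ W),
          co l' hl' i = AffineSpace.coord W.toScheme i := by
        rintro _ rfl _
        exact hco i
      refine Eq.trans ?_ (h2 _ hgO (by rw [hgO]; exact hl0))
      exact (co_comp gO incl hincl _ i).symm

/-! ### Points of the log jet scheme -/

namespace LogScheme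

variable {k : Type u} [Field k] {m : ℕ} {T : Over (Spec (CommRingCat.of k))} {X J : LogScheme k}

/-- The log jet given by a point of the log jet scheme. -/
noncomputable def logJetOf (hJ : (X.logJets m).RepresentableBy J) (u : T ⟶ J.toOver) :
    (thicken m).obj (ofScheme T) ⟶ X :=
  (thicken m).map (ofSchemeHom u) ≫ univLogJet hJ

/-- Morphisms from `T` to the underlying scheme of `J` are log morphisms `ofScheme T ⟶ J`, and these
are log jets because `J` represents the functor on all log schemes, including `ofScheme T`. -/
theorem logJetOf_bijective (hJ : (X.logJets m).RepresentableBy J) :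
    Function.Bijective (logJetOf hJ (T := T)) := by
  have h : ∀ u : T ⟶ J.toOver, hJ.homEquiv (ofSchemeHom u) = logJetOf hJ u :=
    fun u => hJ.homEquiv_eq _
  constructor
  · intro u v huv
    rw [← h, ← h] at huv
    exact congrArg (forget k).map (hJ.homEquiv.injective huv)
  · intro H
    refine ⟨(forget k).map (hJ.homEquiv.symm H), ?_⟩
    refine (h _).symm.trans ?_
    refine Eq.trans (congrArg hJ.homEquiv ?_) (hJ.homEquiv.apply_symm_apply H)
    exact ofSchemeHom_ext rfl

/-- The jet underlying the universal log jet. -/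
noncomputable def univLogJetBase (hJ : (X.logJets m).RepresentableBy J) :
    (thickening m).obj J.toOver ⟶ X.toOver :=
  (forget k).map (univLogJet hJ)

theorem jet_logJetOf (hJ : (X.logJets m).RepresentableBy J) (u : T ⟶ J.toOver) :
    jet (logJetOf hJ u) = (thickening m).map u ≫ univLogJetBase hJ := rfl

theorem logJetOf_comp (hJ : (X.logJets m).RepresentableBy J) {S : Over (Spec (CommRingCat.of k))}
    (u : S ⟶ T) (v : T ⟶ J.toOver) :
    logJetOf hJ (u ≫ v) = (thicken m).map (ofSchemeHom (Y := ofScheme T) u) ≫ logJetOf hJ v := by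
  rw [logJetOf, ofSchemeHom_comp, Functor.map_comp, Category.assoc]
  rfl

theorem comp_logJetProj (hJ : (X.logJets m).RepresentableBy J) (u : T ⟶ J.toOver) :
    u ≫ logJetProj hJ = thickeningZero m T ≫ jet (logJetOf hJ u) := by
  rw [jet_logJetOf, ← Category.assoc (thickeningZero m T), thickeningZero_naturality,
    Category.assoc]
  rfl

/-- The projection `J_m(X)_Z → Z`. -/
noncomputable def logJetsOverProj (hJ : (X.logJets m).RepresentableBy J)
    {Z : Over (Spec (CommRingCat.of k))} (ι : Z ⟶ X.toOver) : logJetsOver hJ ι ⟶ Z :=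
  Over.homMk (pullback.snd (logJetProj hJ).left ι.left) (by
    change _ = pullback.fst (logJetProj hJ).left ι.left ≫ J.toOver.hom
    rw [← Over.w (logJetProj hJ), ← Category.assoc, pullback.condition, Category.assoc, Over.w]
    rfl)

theorem logJetsOver_condition (hJ : (X.logJets m).RepresentableBy J)
    {Z : Over (Spec (CommRingCat.of k))} (ι : Z ⟶ X.toOver) :
    logJetsOverIncl hJ ι ≫ logJetProj hJ = logJetsOverProj hJ ι ≫ ι :=
  Over.OverMorphism.ext pullback.condition

theorem exists_hom_logJetsOver (hJ : (X.logJets m).RepresentableBy J)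
    {Z : Over (Spec (CommRingCat.of k))} (ι : Z ⟶ X.toOver) (u : T ⟶ J.toOver) (ζ : T ⟶ Z)
    (h : u ≫ logJetProj hJ = ζ ≫ ι) :
    ∃ l : T ⟶ logJetsOver hJ ι, l ≫ logJetsOverIncl hJ ι = u := by
  have h' : u.left ≫ (logJetProj hJ).left = ζ.left ≫ ι.left := congrArg (fun f => f.left) h
  refine ⟨Over.homMk (pullback.lift u.left ζ.left h') ?_,
    Over.OverMorphism.ext (pullback.lift_fst _ _ _)⟩
  refine (Category.assoc _ _ _).symm.trans ?_
  exact (congrArg (· ≫ J.toOver.hom) (pullback.lift_fst _ _ _)).trans (Over.w u)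

theorem mono_logJetsOverIncl (hJ : (X.logJets m).RepresentableBy J)
    {Z : Over (Spec (CommRingCat.of k))} (ι : Z ⟶ X.toOver) [Mono ι.left] :
    Mono (logJetsOverIncl hJ ι) := by
  have : Mono (logJetsOverIncl hJ ι).left :=
    inferInstanceAs (Mono (pullback.fst (logJetProj hJ).left ι.left))
  exact Over.mono_of_mono_left _

end LogScheme

open LogScheme

theorem univJet_injective {k : Type u} [Field k] {m : ℕ} {T Z J' : Over (Spec (CommRingCat.of k))}
    (hJ' : (jets m Z).RepresentableBy J') {f g : T ⟶ J'}
    (h : (thickening m).map f ≫ univJet hJ' = (thickening m).map g ≫ univJet hJ') : f = g :=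
  hJ'.homEquiv.injective ((hJ'.homEquiv_eq f).trans (h.trans (hJ'.homEquiv_eq g).symm))

/-- The morphism `π` is locally trivial if it sends log jets to the underlying jets. -/
theorem isLocallyTrivialAffineBundle_of_univJet {k : Type u} [Field k] {X : LogScheme k}
    (hX : X.log.IsFineSaturated) {m j : ℕ} {J : LogScheme k}
    (hJ : (X.logJets m).RepresentableBy J) {Z : Over (Spec (CommRingCat.of k))} {ι : Z ⟶ X.toOver}
    (hι : X.log.IsStratum j ι.left) {J' : Over (Spec (CommRingCat.of k))}
    (hJ' : (jets m Z).RepresentableBy J') {π : logJetsOver hJ ι ⟶ J'}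
    (hπ : (thickening m).map π ≫ univJet hJ' ≫ ι =
      (thickening m).map (logJetsOverIncl hJ ι) ≫ univLogJetBase hJ) :
    IsLocallyTrivialAffineBundle (m * j) π.left := by
  have := hι.isImmersion
  have : Mono ι := Over.mono_of_mono_left _
  have := mono_logJetsOverIncl hJ ι
  have hjet : ∀ {T : Over (Spec (CommRingCat.of k))} (l : T ⟶ logJetsOver hJ ι),
      jet (logJetOf hJ (l ≫ logJetsOverIncl hJ ι)) =
        ((thickening m).map (l ≫ π) ≫ univJet hJ') ≫ ι := by
    intro T l
    rw [jet_logJetOf, Functor.map_comp, Functor.map_comp, Category.assoc, Category.assoc,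
      Category.assoc, hπ]
  -- The starting point of a jet in `Z`, as a point of `X`. It lies in the stratum, so a chart
  -- adapted to rank `j` exists around it.
  let ev : J' ⟶ X.toOver := thickeningZero m J' ≫ univJet hJ' ≫ ι
  have hev : ∀ {T : Over (Spec (CommRingCat.of k))} (h : T ⟶ J'),
      thickeningZero m T ≫ ((thickening m).map h ≫ univJet hJ') ≫ ι = h ≫ ev := by
    intro T h
    rw [Category.assoc, ← Category.assoc (thickeningZero m T), thickeningZero_naturality,
      Category.assoc]
  intro b
  have hb : X.log.rank (ev.left b) = j :=
    (hι.range_eq ▸ Set.mem_range_self ((thickeningZero m J' ≫ univJet hJ').left b) :)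
  obtain ⟨C, hC⟩ : ∃ C : X.log.StratumChart j, ev.left b ∈ C.U := by
    obtain ⟨C, hC⟩ := hX.exists_stratumChart (ev.left b)
    exact hb ▸ ⟨C, hC⟩
  have hUW : ∀ {T : Over (Spec (CommRingCat.of k))} (h : T ⟶ J')
      (_ : ∀ t, h.left t ∈ ev.left ⁻¹ᵁ C.U) y,
      (((thickening m).map h ≫ univJet hJ') ≫ ι).left y ∈ C.U := by
    intro T h hW y
    -- The zero section is surjective on points, so a jet that starts in the domain of the chart
    -- stays in it.
    obtain ⟨t, rfl⟩ := thickeningZero_surjective m T y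
    have h1 := congrArg (fun f : T ⟶ X.toOver => f.left t) (hev h)
    exact h1.symm ▸ (hW t : (h ≫ ev).left t ∈ C.U)
  have hU : ∀ {T : Over (Spec (CommRingCat.of k))} (l : T ⟶ logJetsOver hJ ι)
      (_ : ∀ t, (l ≫ π).left t ∈ ev.left ⁻¹ᵁ C.U) y,
      (jet (logJetOf hJ (l ≫ logJetsOverIncl hJ ι))).left y ∈ C.U := by
    intro T l hl y
    rw [hjet]
    exact hUW _ hl y
  let idx : ULift.{u} (Fin (m * j)) ≃ Fin m × Fin j := Equiv.ulift.trans finProdFinEquiv.symm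
  refine ⟨ev.left ⁻¹ᵁ C.U, hC, exists_iso_affineSpace π (ev.left ⁻¹ᵁ C.U)
    (fun {T} l hl i => chartCoord C (logJetOf hJ (l ≫ logJetsOverIncl hJ ι)) (hU l hl) (idx i))
    ?_ ?_ ?_⟩
  · intro R T u l hl hl' i
    have h1 : ∀ (H : (thicken m).obj (ofScheme R) ⟶ X)
        (hH : H = (thicken m).map (ofSchemeHom (Y := ofScheme T) u) ≫
          logJetOf hJ (l ≫ logJetsOverIncl hJ ι)) (hU' : ∀ y, (jet H).left y ∈ C.U),
        chartCoord C H hU' (idx i) = u.left.appTop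
          (chartCoord C (logJetOf hJ (l ≫ logJetsOverIncl hJ ι)) (hU l hl) (idx i)) := by
      rintro _ rfl hU'
      exact chartCoord_comp C u _ _ hU' _
    exact h1 _ (by rw [Category.assoc, logJetOf_comp]) _
  · intro T h hW a
    -- A jet in `Z` and coordinates `a` give a log jet, hence a point of `J`. As its starting point
    -- lies in `Z`, it lifts to the fibre product `J_m(X)_Z`.
    obtain ⟨H, hH, hco⟩ := exists_chartCoord_eq hι C ((thickening m).map h ≫ univJet hJ')
      (hUW h hW) (a ∘ idx.symm)
    obtain ⟨u, rfl⟩ := (logJetOf_bijective hJ).2 H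
    obtain ⟨l, rfl⟩ := exists_hom_logJetsOver hJ ι u
      (thickeningZero m T ≫ (thickening m).map h ≫ univJet hJ')
      (by rw [comp_logJetProj, hH, Category.assoc, Category.assoc, Category.assoc])
    refine ⟨l, univJet_injective hJ' ?_, fun i => ?_⟩
    · rw [← cancel_mono ι, ← hjet, hH]
    · refine (hco _).trans ?_
      rw [Function.comp_apply, Equiv.symm_apply_apply]
  · intro T l l' hl hl' h hco
    rw [← cancel_mono (logJetsOverIncl hJ ι)]
    refine (logJetOf_bijective hJ).1 ?_
    refine eq_of_chartCoord_eq C (by rw [hjet, hjet, h]) (hU l hl) (hU l' hl') fun i => ?_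
    have h1 := hco (idx.symm i)
    rwa [Equiv.apply_symm_apply] at h1

theorem mainTheorem5 (k : Type u) [Field k] [IsAlgClosed k] [CharZero k]
    -- a fine and saturated log variety over `k`
    (X : LogScheme k) [IsIntegral X.toOver.left] [IsSeparated X.toOver.hom]
    [LocallyOfFiniteType X.toOver.hom] [QuasiCompact X.toOver.hom] (hX : X.log.IsFineSaturated)
    (m j : ℕ)
    -- its log jet scheme `J = J_m(X)`
    (J : LogScheme k) (hJ : (X.logJets m).RepresentableBy J)
    -- its stratum `Z = X_j`
    (Z : Over (Spec (CommRingCat.of k))) (ι : Z ⟶ X.toOver) (hι : X.log.IsStratum j ι.left)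
    -- the jet scheme `J' = J_m(X_j)`
    (J' : Over (Spec (CommRingCat.of k))) (hJ' : (jets m Z).RepresentableBy J') :
    -- the log jets in `J_m(X)_j` have underlying jets in `X_j`, which defines the bundle projection
    ∃ π : LogScheme.logJetsOver hJ ι ⟶ J',
      (thickening m).map π ≫ univJet hJ' ≫ ι =
        (thickening m).map (LogScheme.logJetsOverIncl hJ ι) ≫
          (LogScheme.forget k).map (LogScheme.univLogJet hJ) ∧
      IsLocallyTrivialAffineBundle (m * j) π.left := by
  -- The log jet corresponding to the inclusion of `J_m(X)_j` starts in `Z`, so its underlying jet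
  -- factors through `Z` as `ψ`. The morphism `π` is the point of `J'` that classifies `ψ`.
  obtain ⟨ψ, hψ⟩ := exists_jet_in_stratum hι (logJetOf hJ (logJetsOverIncl hJ ι))
    (logJetsOverProj hJ ι) (by rw [← comp_logJetProj, logJetsOver_condition])
  have h1 : (thickening m).map (hJ'.homEquiv.symm ψ) ≫ univJet hJ' = ψ :=
    (hJ'.homEquiv_eq _).symm.trans (hJ'.homEquiv.apply_symm_apply ψ)
  have h2 : (thickening m).map (hJ'.homEquiv.symm ψ) ≫ univJet hJ' ≫ ι =
      (thickening m).map (logJetsOverIncl hJ ι) ≫ univLogJetBase hJ := by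
    rw [← Category.assoc, h1]
    exact hψ
  exact ⟨_, h2, isLocallyTrivialAffineBundle_of_univJet hX hJ hι hJ' h2⟩
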